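/- Let $k\ge 3$. There is a constant $C_k>0$, depending only on $k$, such that the following holds for every integer $n\ge 2$ with $\gcd(n,(k-1)!)=1$. Let $y=(y_x)_{x\in\mathbb{Z}/n\mathbb{Z}}$ be a family of independent standard normal random variables, and for $\ell\in\{1,3,4,\dots,k\}$ put \[ \overline{\mathbf{kAP}}^{\ell}(y)=\frac1{\sigma_\ell}\sum_{a\in\mathbb{Z}/n\mathbb{Z}}\ \sum_{d=1}^{\lfloor n/2\rfloor}\ \sum_{\substack{S\subseteq\{0,\dots,k-1\}\\ |S|=\ell}}\ \prod_{i\in S}y_{a+id}, \] where $\sigma_\ell>0$ is chosen so that $\operatorname{Var}\big[\overline{\mathbf{kAP}}^{\ell}(y)\big]=1$. For $g\in C^3(\mathbb{R}^{k-1})$ and $r\in\{2,3\}$ let $M_r(g)=\sup_{x\in\mathbb{R}^{k-1}}\|D^rg(x)\|_{\mathrm{op}}\in[0,\infty]$, where $D^rg(x)$ is the $r$-th derivative of $g$ at $x$ as an $r$-linear form and $\|A\|_{\mathrm{op}}=\sup_{|v_1|=\dots=|v_r|=1}|A(v_1,\dots,v_r)|$ with respect to the Euclidean norm. Then for every $g\in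 C^3(\mathbb{R}^{k-1})$, \[ \Big|\mathbb{E}\,g\big(\overline{\mathbf{kAP}}^{1}(y),\overline{\mathbf{kAP}}^{3}(y),\dots,\overline{\mathbf{kAP}}^{k}(y)\big)-\mathbb{E}\,g(Z)\Big|\le C_k\,\frac{M_2(g)+M_3(g)}{n^{1/2}}, \] where $Z$ is a standard Gaussian random vector in $\mathbb{R}^{k-1}$. (If $M_2(g)+M_3(g)<\infty$, both expectations exist; otherwise the bound is vacuous.) -/

import Mathlib

open MeasureTheory ProbabilityTheory
open scoped ENNReal Nat

noncomputable section

/-- The law of a family `(y_x)`, `x ∈ ℤ/nℤ`, of independent standard normal variables. -/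
def gaussianInput (n : ℕ) [NeZero n] : Measure (ZMod n → ℝ) :=
  Measure.pi fun _ => gaussianReal 0 1

/-- The unnormalized degree `ℓ` component
`∑_{a ∈ ℤ/nℤ} ∑_{d = 1}^{⌊n/2⌋} ∑_{S ⊆ {0, …, k-1}, |S| = ℓ} ∏_{i ∈ S} y_{a + i d}`. -/
def apSum (n k ℓ : ℕ) [NeZero n] (y : ZMod n → ℝ) : ℝ :=
  ∑ a : ZMod n, ∑ d ∈ Finset.Icc 1 (n / 2), ∑ S ∈ (Finset.range k).powersetCard ℓ,
    ∏ i ∈ S, y (a + (i : ZMod n) * (d : ZMod n))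

/-- The standard deviation `σ_ℓ` of the degree `ℓ` component at standard Gaussian inputs. -/
def apSigma (n k ℓ : ℕ) [NeZero n] : ℝ :=
  √(variance (apSum n k ℓ) (gaussianInput n))

/-- The degree `ℓ` component, normalized to have variance one at standard Gaussian inputs. -/
def apNormalized (n k ℓ : ℕ) [NeZero n] (y : ZMod n → ℝ) : ℝ :=
  (1 / apSigma n k ℓ) * apSum n k ℓ y

/-- The increasing enumeration `1, 3, 4, 5, …` of the degrees in use (degree `2` is omitted). -/
def apDegree (j : ℕ) : ℕ := if j = 0 then 1 else j + 2

/-- The vector of the normalized components of degrees `1, 3, 4, …, k`. -/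
def apVector (n k : ℕ) [NeZero n] (y : ZMod n → ℝ) : EuclideanSpace ℝ (Fin (k - 1)) :=
  WithLp.toLp 2 fun j => apNormalized n k (apDegree j) y

/-- `M_r(g)`, the supremum over all points (possibly `∞`) of the operator norm of the `r`-th
derivative of `g`, as an `r`-linear form on Euclidean space. -/
def derivSup {m : ℕ} (r : ℕ) (g : EuclideanSpace ℝ (Fin m) → ℝ) : ℝ≥0∞ :=
  ⨆ x, ‖iteratedFDeriv ℝ r g x‖ₑ

end

/-!
Let `F` be the vector of normalized components and `Z` an independent standard Gaussian vector.
Along the circular interpolation `X_θ = sin θ • F + cos θ • Z`, `0 ≤ θ ≤ π / 2`, Gaussian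
integration by parts gives

`d/dθ E g(X_θ) = sin θ cos θ · E ∑ᵢⱼ ∂ᵢⱼ g(X_θ) (Tᵢⱼ - δᵢⱼ)`,  `Tᵢⱼ = ⟨∇Fᵢ, ∇Fⱼ⟩ / ℓⱼ`,

because each `Fⱼ` is multilinear and homogeneous of degree `ℓⱼ`, so that `ℓⱼ Fⱼ` is the divergence
of `∇Fⱼ`. Hence `|E g(F) - E g(Z)| ≤ (π / 2) M₂(g) ∑ᵢⱼ E |Tᵢⱼ - δᵢⱼ|`
(`abs_integral_sub_integral_stdGaussian_le`); only the second derivative of `g` enters.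

Since `E Tᵢⱼ = δᵢⱼ`, it remains to see that `Var Tᵢⱼ = O(1 / n)`. The coprimality hypothesis makes
differences of indices invertible modulo `n`, so two points of a progression together with their
positions determine it, and after normalization the coefficients of the sets through two given
points sum to at most `κ = O(1 / n)` (`isPairSparse_apWeight`). For degrees at least three the
variance is a sum over quadruples of sets: the first two share a removed point, and so do the last
two. A covariance is positive only if every remaining point is covered at least twice and the two
pairs meet (`covariance_monomial_le`). In such a quadruple, suitably ordered, each set after the
first shares two points with the union of its predecessors, with one exception that need share only
one (`chained_of_linked`). The first set contributes a factor `n² κ`, the exceptional one `n κ` and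
the other two `κ` each, up to constants, which leaves total weight `O(n³ κ⁴) = O(1 / n)`
(`variance_gradientPairing_le`).

The component of degree one is exactly `n^{-1/2} ∑ₓ yₓ`, so `T₁₁` is constant, and its pairing with
a component of degree at least three is controlled by `integral_sum_partial_sq_le`, where removing
a point from a set of the second component leaves two points that determine it up to `O(1)` choices.
-/

open MeasureTheory ProbabilityTheory
open scoped ENNReal Nat

set_option linter.unusedSectionVars false

/-! ### Gaussian integration by parts -/

/-- The standard Gaussian measure on `ι → ℝ`. -/
noncomputable abbrev stdNormalPi (ι : Type*) [Fintype ι] : Measure (ι → ℝ) :=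
  Measure.pi fun _ => gaussianReal 0 1

/-- Stein's identity in one variable. -/
theorem integral_mul_gaussianReal_eq_integral_deriv {h h' : ℝ → ℝ}
    (hd : ∀ t, HasDerivAt h (h' t) t) (hh : Integrable h (gaussianReal 0 1))
    (hh' : Integrable h' (gaussianReal 0 1))
    (hth : Integrable (fun t => t * h t) (gaussianReal 0 1)) :
    ∫ t, t * h t ∂(gaussianReal 0 1) = ∫ t, h' t ∂(gaussianReal 0 1) := by
  have key : ∀ f : ℝ → ℝ, Integrable f (gaussianReal 0 1) →
      Integrable (fun t => gaussianPDFReal 0 1 t * f t) := by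
    intro f hf
    rw [gaussianReal_of_var_ne_zero 0 one_ne_zero,
      integrable_withDensity_iff_integrable_smul' (by fun_prop)
        (Filter.Eventually.of_forall fun _ => gaussianPDF_lt_top)] at hf
    simpa [toReal_gaussianPDF] using hf
  have hpdf : ∀ t, HasDerivAt (gaussianPDFReal 0 1) (-t * gaussianPDFReal 0 1 t) t := by
    intro t
    have h1 : HasDerivAt (fun t : ℝ => -(t - 0) ^ 2 / (2 * (1 : NNReal))) (-t) t := by
      have := (((hasDerivAt_id t).sub_const 0).pow 2).neg.div_const (2 * ((1 : NNReal) : ℝ))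
      refine this.congr_deriv ?_
      simp only [id, Nat.cast_ofNat, NNReal.coe_one]
      ring
    have h2 := (h1.exp).const_mul ((√(2 * Real.pi * (1 : NNReal)))⁻¹)
    refine h2.congr_deriv ?_
    simp only [gaussianPDFReal]
    ring
  have h0 := integral_eq_zero_of_hasDerivAt_of_integrable
    (f := fun t => gaussianPDFReal 0 1 t * h t)
    (f' := fun t => gaussianPDFReal 0 1 t * h' t - gaussianPDFReal 0 1 t * (t * h t))
    (fun t => ((hpdf t).mul (hd t)).congr_deriv (by ring))
    ((key _ hh').sub (key _ hth)) (key _ hh)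
  rw [integral_sub (key _ hh') (key _ hth)] at h0
  rw [integral_gaussianReal_eq_integral_smul one_ne_zero,
    integral_gaussianReal_eq_integral_smul one_ne_zero]
  simp only [smul_eq_mul]
  linarith

section Resampling

variable {ι : Type*} [Fintype ι] [DecidableEq ι]

/-- Replacing one coordinate of a standard Gaussian vector by an independent standard normal
variable does not change its law. -/
theorem map_update_stdNormalPi (x : ι) :
    ((stdNormalPi ι).prod (gaussianReal 0 1)).map (fun p => Function.update p.1 x p.2) =
      stdNormalPi ι := by
  have hm : Measurable (fun p : (ι → ℝ) × ℝ => Function.update p.1 x p.2) := measurable_update'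
  refine (Measure.pi_eq fun s hs => ?_).symm
  have hpre : (fun p : (ι → ℝ) × ℝ => Function.update p.1 x p.2) ⁻¹' (Set.univ.pi s) =
      (Set.univ.pi (Function.update s x Set.univ)) ×ˢ (s x) := by
    ext ⟨y, t⟩
    simp only [Set.mem_preimage, Set.mem_pi, Set.mem_univ, true_implies, Set.mem_prod]
    constructor
    · refine fun h => ⟨fun i => ?_, by simpa using h x⟩
      by_cases hi : i = x
      · subst hi; simp
      · simpa [Function.update_of_ne hi] using h i
    · rintro ⟨h, ht⟩ i
      by_cases hi : i = x
      · subst hi; simpa using ht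
      · simpa [Function.update_of_ne hi] using h i
  rw [Measure.map_apply hm (MeasurableSet.univ_pi hs), hpre, Measure.prod_prod, Measure.pi_pi,
    ← Finset.mul_prod_erase _ _ (Finset.mem_univ x),
    ← Finset.mul_prod_erase _ (fun i => (gaussianReal 0 1) (s i)) (Finset.mem_univ x)]
  rw [Function.update_self, measure_univ, one_mul, mul_comm]
  congr 1
  refine Finset.prod_congr rfl fun i hi => ?_
  rw [Function.update_of_ne (Finset.ne_of_mem_erase hi)]

/-- Gaussian integration by parts in the coordinate `x`. -/
theorem integral_coord_mul_stdNormalPi (x : ι) {H H' : (ι → ℝ) → ℝ}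
    (hd : ∀ w, HasDerivAt (fun t => H (Function.update w x t)) (H' w) (w x))
    (hH : Integrable H (stdNormalPi ι)) (hH' : Integrable H' (stdNormalPi ι))
    (hxH : Integrable (fun w => w x * H w) (stdNormalPi ι)) :
    ∫ w, w x * H w ∂(stdNormalPi ι) = ∫ w, H' w ∂(stdNormalPi ι) := by
  set u : (ι → ℝ) × ℝ → (ι → ℝ) := fun p => Function.update p.1 x p.2 with hu
  have hm : Measurable u := measurable_update'
  have hmp : MeasurePreserving u ((stdNormalPi ι).prod (gaussianReal 0 1)) (stdNormalPi ι) :=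
    ⟨hm, map_update_stdNormalPi x⟩
  have key : ∀ {f : (ι → ℝ) → ℝ}, Integrable f (stdNormalPi ι) →
      ∫ w, f w ∂(stdNormalPi ι) =
        ∫ w, ∫ t, f (Function.update w x t) ∂(gaussianReal 0 1) ∂(stdNormalPi ι) := by
    intro f hf
    have h1 : Integrable f (Measure.map u ((stdNormalPi ι).prod (gaussianReal 0 1))) := by
      rwa [hmp.map_eq]
    rw [← integral_prod (fun p => f (u p)) (hmp.integrable_comp_of_integrable hf), ← hmp.map_eq,
      integral_map hm.aemeasurable h1.aestronglyMeasurable, hmp.map_eq]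
  rw [key hxH, key hH']
  refine integral_congr_ae ?_
  filter_upwards [(hmp.integrable_comp_of_integrable hH).prod_right_ae,
    (hmp.integrable_comp_of_integrable hH').prod_right_ae,
    (hmp.integrable_comp_of_integrable hxH).prod_right_ae] with w h1 h2 h3
  simp only [Function.comp_def, hu] at h1 h2 h3
  simp only [Function.update_self] at h3 ⊢
  refine integral_mul_gaussianReal_eq_integral_deriv (fun t => ?_) h1 h2 h3
  simpa using hd (Function.update w x t)

end Resampling

/-! ### Continuous functions of polynomial growth -/

instance isGaussian_stdNormalPi {ι : Type*} [Fintype ι] : IsGaussian (stdNormalPi ι) := by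
  have h : stdNormalPi ι =
      (stdGaussian (EuclideanSpace ℝ ι)).map (EuclideanSpace.equiv ι ℝ) := by
    rw [← map_pi_eq_stdGaussian, Measure.map_map (by fun_prop) (by fun_prop)]
    exact Measure.map_id.symm
  rw [h]
  infer_instance

/-- Continuous functions on `ι → ℝ` bounded by a polynomial in the norm. -/
def PolyGrowth {ι E : Type*} [Fintype ι] [NormedAddCommGroup E] (f : (ι → ℝ) → E) : Prop :=
  Continuous f ∧ ∃ C : ℝ, ∃ N : ℕ, ∀ w, ‖f w‖ ≤ C * (1 + ‖w‖) ^ N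

namespace PolyGrowth

variable {ι E F : Type*} [Fintype ι] [NormedAddCommGroup E] [NormedAddCommGroup F]

theorem const (c : E) : PolyGrowth (fun _ : ι → ℝ => c) :=
  ⟨continuous_const, ‖c‖, 0, by simp⟩

theorem coord (x : ι) : PolyGrowth (fun w : ι → ℝ => w x) :=
  ⟨continuous_apply x, 1, 1, fun w => by linarith [norm_le_pi_norm w x]⟩

/-- A bound by a polynomially growing function, one that may take its values elsewhere. -/
theorem of_le {f : (ι → ℝ) → E} {g : (ι → ℝ) → F} (hf : Continuous f) (hg : PolyGrowth g)
    (h : ∀ w, ‖f w‖ ≤ ‖g w‖) : PolyGrowth f := by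
  obtain ⟨-, C, N, hC⟩ := hg
  exact ⟨hf, C, N, fun w => (h w).trans (hC w)⟩

theorem norm {f : (ι → ℝ) → E} (hf : PolyGrowth f) : PolyGrowth (fun w => ‖f w‖) :=
  of_le hf.1.norm hf (by simp)

theorem add {f g : (ι → ℝ) → E} (hf : PolyGrowth f) (hg : PolyGrowth g) :
    PolyGrowth (fun w => f w + g w) := by
  obtain ⟨hfc, C, N, hC⟩ := hf
  obtain ⟨hgc, C', N', hC'⟩ := hg
  refine ⟨hfc.add hgc, |C| + |C'|, N + N', fun w => ?_⟩
  have h1 : (1 : ℝ) ≤ 1 + ‖w‖ := by linarith [norm_nonneg w]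
  calc ‖f w + g w‖ ≤ ‖f w‖ + ‖g w‖ := norm_add_le _ _
    _ ≤ |C| * (1 + ‖w‖) ^ N + |C'| * (1 + ‖w‖) ^ N' := by
        refine add_le_add ((hC w).trans ?_) ((hC' w).trans ?_) <;> gcongr <;> exact le_abs_self _
    _ ≤ |C| * (1 + ‖w‖) ^ (N + N') + |C'| * (1 + ‖w‖) ^ (N + N') := by
        gcongr <;> omega
    _ = _ := by ring

theorem smul [NormedSpace ℝ E] {f : (ι → ℝ) → ℝ} {g : (ι → ℝ) → E} (hf : PolyGrowth f)
    (hg : PolyGrowth g) : PolyGrowth (fun w => f w • g w) := by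
  obtain ⟨hfc, C, N, hC⟩ := hf
  obtain ⟨hgc, C', N', hC'⟩ := hg
  refine ⟨hfc.smul hgc, |C| * C', N + N', fun w => ?_⟩
  rw [norm_smul, pow_add, mul_mul_mul_comm]
  have h2 : ‖f w‖ ≤ |C| * (1 + ‖w‖) ^ N :=
    (hC w).trans (by gcongr; exact le_abs_self _)
  exact mul_le_mul h2 (hC' w) (norm_nonneg _) (by positivity)

theorem mul {f g : (ι → ℝ) → ℝ} (hf : PolyGrowth f) (hg : PolyGrowth g) :
    PolyGrowth (fun w => f w * g w) := hf.smul hg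

theorem sum {α : Type*} (s : Finset α) {f : α → (ι → ℝ) → E} (hf : ∀ a ∈ s, PolyGrowth (f a)) :
    PolyGrowth (fun w => ∑ a ∈ s, f a w) := by
  classical
  induction s using Finset.induction_on with
  | empty => simpa using const (0 : E)
  | insert a s ha ih =>
    simp only [Finset.sum_insert ha]
    exact (hf a (by simp)).add (ih fun b hb => hf b (by simp [hb]))

theorem prod {α : Type*} (s : Finset α) {f : α → (ι → ℝ) → ℝ} (hf : ∀ a ∈ s, PolyGrowth (f a)) :
    PolyGrowth (fun w => ∏ a ∈ s, f a w) := by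
  classical
  induction s using Finset.induction_on with
  | empty => simpa using const (1 : ℝ)
  | insert a s ha ih =>
    simp only [Finset.prod_insert ha]
    exact (hf a (by simp)).mul (ih fun b hb => hf b (by simp [hb]))

theorem pow {f : (ι → ℝ) → ℝ} (hf : PolyGrowth f) (m : ℕ) : PolyGrowth (fun w => f w ^ m) := by
  simpa using prod (Finset.range m) (f := fun _ => f) fun _ _ => hf

theorem comp_inl {κ : Type*} [Fintype κ] {f : (ι → ℝ) → E} (hf : PolyGrowth f) :
    PolyGrowth (fun w : ι ⊕ κ → ℝ => f (w ∘ Sum.inl)) := by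
  obtain ⟨hfc, C, N, hC⟩ := hf
  refine ⟨hfc.comp (by fun_prop), |C|, N, fun w => (hC _).trans ?_⟩
  have : ‖w ∘ Sum.inl‖ ≤ ‖w‖ :=
    (pi_norm_le_iff_of_nonneg (norm_nonneg _)).2 fun i => norm_le_pi_norm w _
  gcongr
  exact le_abs_self _

/-- Polynomially growing functions have finite Gaussian moments, by Fernique's theorem. -/
theorem integrable {f : (ι → ℝ) → E} [NormedSpace ℝ E] [SecondCountableTopology E]
    (hf : PolyGrowth f) : Integrable f (stdNormalPi ι) := by
  obtain ⟨hfc, C, N, hC⟩ := hf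
  have hid : MemLp (fun w : ι → ℝ => ‖w‖) N (stdNormalPi ι) :=
    (IsGaussian.memLp_id (stdNormalPi ι) N (ENNReal.natCast_ne_top N)).norm
  have h0 : MemLp (fun w : ι → ℝ => 1 + ‖w‖) N (stdNormalPi ι) := (memLp_const (1 : ℝ)).add hid
  have h1 : Integrable (fun w : ι → ℝ => (1 + ‖w‖) ^ N) (stdNormalPi ι) := by
    refine h0.integrable_norm_pow'.congr (Filter.Eventually.of_forall fun w => ?_)
    have : 0 ≤ 1 + ‖w‖ := by positivity
    change ‖1 + ‖w‖‖ ^ N = _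
    rw [Real.norm_of_nonneg this]
  exact (h1.const_mul C).mono' hfc.aestronglyMeasurable (Filter.Eventually.of_forall hC)

end PolyGrowth

/-! ### Functions with bounded second derivative -/

section BoundedHessian

variable {E : Type*} [NormedAddCommGroup E] [NormedSpace ℝ E] {g : E → ℝ} {M : ℝ}

theorem norm_fderiv_le_of_norm_fderiv_fderiv_le (hg : ContDiff ℝ 2 g)
    (hM : ∀ v, ‖fderiv ℝ (fderiv ℝ g) v‖ ≤ M) (v : E) :
    ‖fderiv ℝ g v‖ ≤ ‖fderiv ℝ g 0‖ + M * ‖v‖ := by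
  have hd : Differentiable ℝ (fderiv ℝ g) :=
    (hg.fderiv_right (m := 1) (by norm_num)).differentiable (by norm_num)
  have h := convex_univ.norm_image_sub_le_of_norm_fderiv_le (𝕜 := ℝ) (f := fderiv ℝ g)
    (fun x _ => hd x) (fun x _ => hM x) (Set.mem_univ (0 : E)) (Set.mem_univ v)
  rw [sub_zero] at h
  have h2 := norm_add_le (fderiv ℝ g 0) (fderiv ℝ g v - fderiv ℝ g 0)
  rw [add_sub_cancel] at h2
  linarith

theorem norm_le_of_norm_fderiv_fderiv_le (hg : ContDiff ℝ 2 g)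
    (hM : ∀ v, ‖fderiv ℝ (fderiv ℝ g) v‖ ≤ M) (v : E) :
    ‖g v‖ ≤ ‖g 0‖ + (‖fderiv ℝ g 0‖ + M * ‖v‖) * ‖v‖ := by
  have hM0 : 0 ≤ M := le_trans (norm_nonneg (fderiv ℝ (fderiv ℝ g) 0)) (hM 0)
  have h := (convex_closedBall (0 : E) ‖v‖).norm_image_sub_le_of_norm_fderiv_le (𝕜 := ℝ)
    (f := g) (C := ‖fderiv ℝ g 0‖ + M * ‖v‖)
    (fun x _ => (hg.differentiable (by norm_num)) x)
    (fun x hx => (norm_fderiv_le_of_norm_fderiv_fderiv_le hg hM x).trans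
      (by have : ‖x‖ ≤ ‖v‖ := by simpa using hx
          gcongr))
    (Metric.mem_closedBall_self (norm_nonneg _)) (y := v) (by simp)
  rw [sub_zero] at h
  have h2 := norm_add_le (g 0) (g v - g 0)
  rw [add_sub_cancel] at h2
  linarith

variable {ι : Type*} [Fintype ι] {X : (ι → ℝ) → E}

theorem PolyGrowth.comp_of_norm_fderiv_fderiv_le (hg : ContDiff ℝ 2 g)
    (hM : ∀ v, ‖fderiv ℝ (fderiv ℝ g) v‖ ≤ M) (hX : PolyGrowth X) :
    PolyGrowth (fun w => g (X w)) := by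
  refine PolyGrowth.of_le (hg.continuous.comp hX.1) ((PolyGrowth.const ‖g 0‖).add
    (((PolyGrowth.const ‖fderiv ℝ g 0‖).add ((PolyGrowth.const M).mul hX.norm)).mul hX.norm))
    fun w => ?_
  exact (norm_le_of_norm_fderiv_fderiv_le hg hM _).trans (Real.le_norm_self _)

theorem PolyGrowth.fderiv_comp_of_norm_fderiv_fderiv_le (hg : ContDiff ℝ 2 g)
    (hM : ∀ v, ‖fderiv ℝ (fderiv ℝ g) v‖ ≤ M) (hX : PolyGrowth X) (e : E) :
    PolyGrowth (fun w => fderiv ℝ g (X w) e) := by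
  have hc : Continuous (fderiv ℝ g) := hg.continuous_fderiv (by norm_num)
  refine PolyGrowth.of_le ((hc.comp hX.1).clm_apply continuous_const)
    (((PolyGrowth.const ‖fderiv ℝ g 0‖).add ((PolyGrowth.const M).mul hX.norm)).mul
      (PolyGrowth.const ‖e‖)) fun w => ?_
  refine ((fderiv ℝ g (X w)).le_opNorm e).trans (le_trans ?_ (Real.le_norm_self _))
  gcongr
  exact norm_fderiv_le_of_norm_fderiv_fderiv_le hg hM _

theorem PolyGrowth.fderiv_fderiv_comp_of_norm_le (hg : ContDiff ℝ 2 g)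
    (hM : ∀ v, ‖fderiv ℝ (fderiv ℝ g) v‖ ≤ M) (hX : PolyGrowth X) (e e' : E) :
    PolyGrowth (fun w => fderiv ℝ (fderiv ℝ g) (X w) e e') := by
  have hc : Continuous (fderiv ℝ (fderiv ℝ g)) :=
    (hg.fderiv_right (m := 1) (by norm_num)).continuous_fderiv (by norm_num)
  refine PolyGrowth.of_le (((hc.comp hX.1).clm_apply continuous_const).clm_apply continuous_const)
    (PolyGrowth.const (M * ‖e‖ * ‖e'‖)) fun w => ?_
  refine ((fderiv ℝ (fderiv ℝ g) (X w)).le_opNorm₂ e e').trans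
    (le_trans ?_ (Real.le_norm_self _))
  gcongr
  exact hM _

end BoundedHessian

/-! ### Gaussian interpolation -/

/-- `F` is a function of polynomial growth on `V → ℝ` which is affine in each coordinate and
homogeneous of degree `ℓ`, and `D x` is its derivative in the coordinate `x`; affinity is recorded
as independence of `D x` from the coordinate `x`, homogeneity as Euler's identity. -/
structure IsMultiaffineHomogeneous {V : Type*} [Fintype V] [DecidableEq V] (ℓ : ℝ)
    (F : (V → ℝ) → ℝ) (D : V → (V → ℝ) → ℝ) : Prop where
  polyGrowth : PolyGrowth F
  polyGrowth_deriv : ∀ x, PolyGrowth (D x)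
  hasDerivAt : ∀ x y, HasDerivAt (fun t => F (Function.update y x t)) (D x y) (y x)
  deriv_update : ∀ x y t, D x (Function.update y x t) = D x y
  euler : ∀ y, ∑ x, y x * D x y = ℓ * F y

section Interpolation

variable {V J : Type*} [Fintype V] [DecidableEq V] [Fintype J] [DecidableEq J]

theorem update_comp_inl_of_inl (w : V ⊕ J → ℝ) (x : V) (t : ℝ) :
    Function.update w (Sum.inl x) t ∘ Sum.inl = Function.update (w ∘ Sum.inl) x t :=
  Sum.update_inl_comp_inl

/-- Integration by parts against a homogeneous multiaffine function: `ℓ` times the function is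
the divergence of its gradient, because each `D x` is free of the coordinate `x`. -/
theorem IsMultiaffineHomogeneous.integral_mul {ℓ : ℝ} {F : (V → ℝ) → ℝ} {D : V → (V → ℝ) → ℝ}
    (hF : IsMultiaffineHomogeneous ℓ F D) {u : (V ⊕ J → ℝ) → ℝ} {u' : V → (V ⊕ J → ℝ) → ℝ}
    (hu : PolyGrowth u) (hu' : ∀ x, PolyGrowth (u' x))
    (hd : ∀ x w, HasDerivAt (fun t => u (Function.update w (Sum.inl x) t)) (u' x w)
      (w (Sum.inl x))) :
    ℓ * ∫ w, F (w ∘ Sum.inl) * u w ∂(stdNormalPi (V ⊕ J)) =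
      ∫ w, ∑ x, D x (w ∘ Sum.inl) * u' x w ∂(stdNormalPi (V ⊕ J)) := by
  have hD : ∀ x, PolyGrowth (fun w : V ⊕ J → ℝ => D x (w ∘ Sum.inl)) :=
    fun x => (hF.polyGrowth_deriv x).comp_inl
  have h1 : ∀ x, ∫ w, w (Sum.inl x) * (D x (w ∘ Sum.inl) * u w) ∂(stdNormalPi (V ⊕ J)) =
      ∫ w, D x (w ∘ Sum.inl) * u' x w ∂(stdNormalPi (V ⊕ J)) := by
    intro x
    refine integral_coord_mul_stdNormalPi (Sum.inl x) (H := fun w => D x (w ∘ Sum.inl) * u w)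
      (fun w => ?_) ((hD x).mul hu).integrable
      ((hD x).mul (hu' x)).integrable ((PolyGrowth.coord _).mul ((hD x).mul hu)).integrable
    simp only [update_comp_inl_of_inl, hF.deriv_update]
    exact (hd x w).const_mul _
  rw [integral_finsetSum _ fun x _ => ((hD x).mul (hu' x)).integrable, ← integral_const_mul]
  simp_rw [← h1]
  rw [← integral_finsetSum _ fun x _ =>
    ((PolyGrowth.coord _).mul ((hD x).mul hu)).integrable]
  refine integral_congr_ae (Filter.Eventually.of_forall fun w => ?_)
  simp only
  rw [← mul_assoc, ← hF.euler, Finset.sum_mul]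
  exact Finset.sum_congr rfl fun x _ => by simp only [Function.comp_apply]; ring

/-- The circular interpolation `sin θ • F + cos θ • Z` between an independent standard Gaussian
vector `Z` and the vector `F`. -/
noncomputable def interpolation (F : J → (V → ℝ) → ℝ) (θ : ℝ) (w : V ⊕ J → ℝ) :
    EuclideanSpace ℝ J :=
  ∑ j, (Real.sin θ * F j (w ∘ Sum.inl) + Real.cos θ * w (Sum.inr j)) •
    EuclideanSpace.single j (1 : ℝ)

theorem sum_smul_single (c : J → ℝ) :
    ∑ j, c j • EuclideanSpace.single j (1 : ℝ) = WithLp.toLp 2 c := by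
  ext i
  simp [Finset.sum_apply, Pi.single_apply]

theorem integral_comp_inl {f : (V → ℝ) → ℝ} (hf : Continuous f) :
    ∫ w, f (w ∘ Sum.inl) ∂(stdNormalPi (V ⊕ J)) = ∫ y, f y ∂(stdNormalPi V) := by
  have h : MeasurePreserving _ (stdNormalPi (V ⊕ J)) (stdNormalPi V) :=
    measurePreserving_fst.comp (measurePreserving_sumPiEquivProdPi
      (fun _ : V ⊕ J => gaussianReal 0 1))
  rw [← h.map_eq, integral_map h.measurable.aemeasurable hf.aestronglyMeasurable]
  rfl

theorem integral_comp_inr {f : (J → ℝ) → ℝ} (hf : Continuous f) :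
    ∫ w, f (w ∘ Sum.inr) ∂(stdNormalPi (V ⊕ J)) = ∫ y, f y ∂(stdNormalPi J) := by
  have h : MeasurePreserving _ (stdNormalPi (V ⊕ J)) (stdNormalPi J) :=
    measurePreserving_snd.comp (measurePreserving_sumPiEquivProdPi
      (fun _ : V ⊕ J => gaussianReal 0 1))
  rw [← h.map_eq, integral_map h.measurable.aemeasurable hf.aestronglyMeasurable]
  rfl

variable {F : J → (V → ℝ) → ℝ} {D : J → V → (V → ℝ) → ℝ} {ℓ : J → ℝ}

/-- The Gram matrix `⟨∇Fᵢ, ∇Fⱼ⟩ / ℓⱼ` of the gradients; its mean is the covariance matrix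
of `F`. -/
noncomputable def gradientGram (ℓ : J → ℝ) (D : J → V → (V → ℝ) → ℝ) (i j : J) (y : V → ℝ) : ℝ :=
  (ℓ j)⁻¹ * ∑ x, D i x y * D j x y

theorem polyGrowth_gradientGram (hF : ∀ j, IsMultiaffineHomogeneous (ℓ j) (F j) (D j)) (i j : J) :
    PolyGrowth (gradientGram ℓ D i j) :=
  (PolyGrowth.const _).mul (PolyGrowth.sum _ fun x _ =>
    ((hF i).polyGrowth_deriv x).mul ((hF j).polyGrowth_deriv x))

theorem polyGrowth_interpolation (hF : ∀ j, IsMultiaffineHomogeneous (ℓ j) (F j) (D j)) (θ : ℝ) :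
    PolyGrowth (interpolation F θ) :=
  PolyGrowth.sum _ fun j _ => (((PolyGrowth.const _).mul (hF j).polyGrowth.comp_inl).add
    ((PolyGrowth.const _).mul (PolyGrowth.coord _))).smul (PolyGrowth.const _)

theorem hasDerivAt_interpolation_inl
    (hF : ∀ j, IsMultiaffineHomogeneous (ℓ j) (F j) (D j)) (θ : ℝ) (x : V) (w : V ⊕ J → ℝ) :
    HasDerivAt (fun t => interpolation F θ (Function.update w (Sum.inl x) t))
      (∑ i, (Real.sin θ * D i x (w ∘ Sum.inl)) • EuclideanSpace.single i (1 : ℝ))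
      (w (Sum.inl x)) := by
  unfold interpolation
  refine HasDerivAt.fun_sum fun i _ => HasDerivAt.smul_const ?_ _
  simp only [update_comp_inl_of_inl, Function.update_of_ne (Sum.inr_ne_inl (a := x) (b := i))]
  exact (((hF i).hasDerivAt x (w ∘ Sum.inl)).const_mul (Real.sin θ)).add_const _

theorem hasDerivAt_interpolation_inr (θ : ℝ) (j : J) (w : V ⊕ J → ℝ) :
    HasDerivAt (fun t => interpolation F θ (Function.update w (Sum.inr j) t))
      (Real.cos θ • EuclideanSpace.single j (1 : ℝ)) (w (Sum.inr j)) := by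
  have h : ∀ t, interpolation F θ (Function.update w (Sum.inr j) t) =
      interpolation F θ w +
        (t - w (Sum.inr j)) • Real.cos θ • EuclideanSpace.single j (1 : ℝ) := by
    intro t
    simp only [interpolation, Sum.update_inr_comp_inl]
    rw [← Finset.add_sum_erase _ _ (Finset.mem_univ j),
      ← Finset.add_sum_erase _ (fun j => (Real.sin θ * F j (w ∘ Sum.inl) +
        Real.cos θ * w (Sum.inr j)) • EuclideanSpace.single j (1 : ℝ)) (Finset.mem_univ j)]
    have : ∀ i ∈ Finset.univ.erase j, Function.update w (Sum.inr j) t (Sum.inr i) =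
        w (Sum.inr i) := fun i hi => by
      rw [Function.update_of_ne]
      simpa using Finset.ne_of_mem_erase hi
    rw [Finset.sum_congr rfl fun i hi => by rw [this i hi], Function.update_self]
    module
  simp only [h]
  simpa using (((hasDerivAt_id (w (Sum.inr j))).sub_const (w (Sum.inr j))).smul_const
    (Real.cos θ • EuclideanSpace.single j (1 : ℝ))).const_add (interpolation F θ w)

variable {g : EuclideanSpace ℝ J → ℝ} {M : ℝ}

/-- The derivative of the interpolated expectation, before integration by parts. -/
theorem hasDerivAt_integral_interpolation (hg : ContDiff ℝ 2 g)
    (hM : ∀ v, ‖fderiv ℝ (fderiv ℝ g) v‖ ≤ M)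
    (hF : ∀ j, IsMultiaffineHomogeneous (ℓ j) (F j) (D j)) (θ : ℝ) :
    HasDerivAt (fun θ => ∫ w, g (interpolation F θ w) ∂(stdNormalPi (V ⊕ J)))
      (∫ w, fderiv ℝ g (interpolation F θ w)
        (∑ j, (Real.cos θ * F j (w ∘ Sum.inl) + -Real.sin θ * w (Sum.inr j)) •
          EuclideanSpace.single j (1 : ℝ)) ∂(stdNormalPi (V ⊕ J))) θ := by
  have hM0 : 0 ≤ M := le_trans (norm_nonneg (fderiv ℝ (fderiv ℝ g) 0)) (hM 0)
  let R : (V ⊕ J → ℝ) → ℝ := fun w => ∑ j, (‖F j (w ∘ Sum.inl)‖ + ‖w (Sum.inr j)‖)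
  have hR : PolyGrowth R :=
    PolyGrowth.sum _ fun j _ => (hF j).polyGrowth.comp_inl.norm.add (PolyGrowth.coord _).norm
  have hbd : ∀ (a b : ℝ), |a| ≤ 1 → |b| ≤ 1 → ∀ w : V ⊕ J → ℝ,
      ‖∑ j, (a * F j (w ∘ Sum.inl) + b * w (Sum.inr j)) • EuclideanSpace.single j (1 : ℝ)‖
        ≤ R w := by
    intro a b ha hb w
    refine (norm_sum_le _ _).trans (Finset.sum_le_sum fun j _ => ?_)
    rw [norm_smul, PiLp.norm_single, norm_one, mul_one]
    refine (norm_add_le _ _).trans (add_le_add ?_ ?_) <;> rw [norm_mul] <;>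
      exact mul_le_of_le_one_left (norm_nonneg _) (by assumption)
  have hX := polyGrowth_interpolation (F := F) hF
  have hbint : PolyGrowth (fun w => (‖fderiv ℝ g 0‖ + M * R w) * R w) :=
    ((PolyGrowth.const _).add ((PolyGrowth.const _).mul hR)).mul hR
  have hV : PolyGrowth (fun w : V ⊕ J → ℝ => ∑ j, (Real.cos θ * F j (w ∘ Sum.inl) +
      -Real.sin θ * w (Sum.inr j)) • EuclideanSpace.single j (1 : ℝ)) :=
    PolyGrowth.sum _ fun j _ => (((PolyGrowth.const _).mul (hF j).polyGrowth.comp_inl).add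
      ((PolyGrowth.const _).mul (PolyGrowth.coord _))).smul (PolyGrowth.const _)
  refine (hasDerivAt_integral_of_dominated_loc_of_deriv_le (s := Set.univ)
    (F' := fun θ w => fderiv ℝ g (interpolation F θ w)
        (∑ j, (Real.cos θ * F j (w ∘ Sum.inl) + -Real.sin θ * w (Sum.inr j)) •
          EuclideanSpace.single j (1 : ℝ)))
    Filter.univ_mem ?_ ?_ ?_ (Filter.Eventually.of_forall fun w t _ => ?_) hbint.integrable
    (Filter.Eventually.of_forall fun w t _ => ?_)).2
  · exact Filter.Eventually.of_forall fun t =>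
      (hg.continuous.comp (hX t).1).aestronglyMeasurable
  · exact (PolyGrowth.comp_of_norm_fderiv_fderiv_le hg hM (hX θ)).integrable
  · exact (((hg.continuous_fderiv (by norm_num)).comp (hX θ).1).clm_apply
      hV.1).aestronglyMeasurable
  · refine ((fderiv ℝ g (interpolation F t w)).le_opNorm _).trans ?_
    refine mul_le_mul ?_ ?_ (norm_nonneg _) (by positivity)
    · refine (norm_fderiv_le_of_norm_fderiv_fderiv_le hg hM _).trans ?_
      gcongr
      exact hbd _ _ (Real.abs_sin_le_one t) (Real.abs_cos_le_one t) w
    · exact hbd _ _ (Real.abs_cos_le_one t) (by simpa using Real.abs_sin_le_one t) w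
  · refine ((hg.differentiable (by norm_num)) _).hasFDerivAt.comp_hasDerivAt t ?_
    unfold interpolation
    refine HasDerivAt.fun_sum fun i _ => HasDerivAt.smul_const ?_ _
    exact ((Real.hasDerivAt_sin t).mul_const _).add ((Real.hasDerivAt_cos t).mul_const _)

/-- The derivative of the interpolated expectation after integration by parts: the Hessian of `g`
is tested against the deviation of the gradient Gram matrix from the identity. -/
theorem integral_fderiv_interpolation (hg : ContDiff ℝ 2 g)
    (hM : ∀ v, ‖fderiv ℝ (fderiv ℝ g) v‖ ≤ M)
    (hF : ∀ j, IsMultiaffineHomogeneous (ℓ j) (F j) (D j)) (hℓ : ∀ j, ℓ j ≠ 0) (θ : ℝ) :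
    ∫ w, fderiv ℝ g (interpolation F θ w)
        (∑ j, (Real.cos θ * F j (w ∘ Sum.inl) + -Real.sin θ * w (Sum.inr j)) •
          EuclideanSpace.single j (1 : ℝ)) ∂(stdNormalPi (V ⊕ J)) =
      ∫ w, Real.sin θ * Real.cos θ * ∑ i, ∑ j,
        fderiv ℝ (fderiv ℝ g) (interpolation F θ w) (EuclideanSpace.single i (1 : ℝ))
          (EuclideanSpace.single j (1 : ℝ)) *
        (gradientGram ℓ D i j (w ∘ Sum.inl) - if i = j then 1 else 0)
        ∂(stdNormalPi (V ⊕ J)) := by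
  have hX := polyGrowth_interpolation (F := F) hF θ
  have hG : ∀ j, PolyGrowth (fun w => fderiv ℝ g (interpolation F θ w)
      (EuclideanSpace.single j (1 : ℝ))) :=
    fun j => PolyGrowth.fderiv_comp_of_norm_fderiv_fderiv_le hg hM hX _
  have hH : ∀ i j, PolyGrowth (fun w => fderiv ℝ (fderiv ℝ g) (interpolation F θ w)
      (EuclideanSpace.single i (1 : ℝ)) (EuclideanSpace.single j (1 : ℝ))) :=
    fun i j => PolyGrowth.fderiv_fderiv_comp_of_norm_le hg hM hX _ _
  have hD : ∀ i x, PolyGrowth (fun w : V ⊕ J → ℝ => D i x (w ∘ Sum.inl)) :=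
    fun i x => ((hF i).polyGrowth_deriv x).comp_inl
  have hT : ∀ i j, PolyGrowth (fun w : V ⊕ J → ℝ => gradientGram ℓ D i j (w ∘ Sum.inl)) :=
    fun i j => (polyGrowth_gradientGram hF i j).comp_inl
  have hd2 : Differentiable ℝ (fderiv ℝ g) :=
    (hg.fderiv_right (m := 1) (by norm_num)).differentiable (by norm_num)
  -- integration by parts in the coordinates of the chaos
  have h1 : ∀ j, ∫ w, F j (w ∘ Sum.inl) * fderiv ℝ g (interpolation F θ w)
        (EuclideanSpace.single j (1 : ℝ)) ∂(stdNormalPi (V ⊕ J)) =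
      ∫ w, Real.sin θ * ∑ i, fderiv ℝ (fderiv ℝ g) (interpolation F θ w)
        (EuclideanSpace.single i (1 : ℝ)) (EuclideanSpace.single j (1 : ℝ)) *
          gradientGram ℓ D i j (w ∘ Sum.inl) ∂(stdNormalPi (V ⊕ J)) := by
    intro j
    have h := (hF j).integral_mul (hG j)
      (u' := fun x w => ∑ i, Real.sin θ * D i x (w ∘ Sum.inl) *
        fderiv ℝ (fderiv ℝ g) (interpolation F θ w)
          (EuclideanSpace.single i (1 : ℝ)) (EuclideanSpace.single j (1 : ℝ)))
      (fun x => PolyGrowth.sum _ fun i _ => ((PolyGrowth.const _).mul (hD i x)).mul (hH i j))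
      (fun x w => by
        have hc := (hasDerivAt_interpolation_inl hF θ x w)
        have hc2 := (hd2 (interpolation F θ w)).hasFDerivAt
        have hc3 := hc2.comp_hasDerivAt_of_eq (w (Sum.inl x)) hc (by simp)
        refine (hc3.clm_apply (hasDerivAt_const _ _)).congr_deriv ?_
        simp [map_sum])
    rw [← mul_right_inj' (hℓ j), h, ← integral_const_mul]
    refine integral_congr_ae (Filter.Eventually.of_forall fun w => ?_)
    simp only [gradientGram, Finset.mul_sum]
    rw [Finset.sum_comm]
    refine Finset.sum_congr rfl fun i _ => Finset.sum_congr rfl fun x _ => ?_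
    have := hℓ j
    field_simp
  -- integration by parts in the coordinates of the Gaussian vector
  have h2 : ∀ j, ∫ w, w (Sum.inr j) * fderiv ℝ g (interpolation F θ w)
        (EuclideanSpace.single j (1 : ℝ)) ∂(stdNormalPi (V ⊕ J)) =
      ∫ w, Real.cos θ * fderiv ℝ (fderiv ℝ g) (interpolation F θ w)
        (EuclideanSpace.single j (1 : ℝ)) (EuclideanSpace.single j (1 : ℝ))
          ∂(stdNormalPi (V ⊕ J)) := by
    intro j
    refine integral_coord_mul_stdNormalPi (Sum.inr j)
      (H := fun w => fderiv ℝ g (interpolation F θ w) (EuclideanSpace.single j (1 : ℝ)))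
      (fun w => ?_) (hG j).integrable ((PolyGrowth.const _).mul (hH j j)).integrable
      ((PolyGrowth.coord _).mul (hG j)).integrable
    have hc := (hasDerivAt_interpolation_inr (F := F) θ j w)
    have hc2 := (hd2 (interpolation F θ w)).hasFDerivAt
    have hc3 := hc2.comp_hasDerivAt_of_eq (w (Sum.inr j)) hc (by simp)
    refine (hc3.clm_apply (hasDerivAt_const _ _)).congr_deriv ?_
    simp
  have hFG : ∀ j, PolyGrowth (fun w => F j (w ∘ Sum.inl) *
      fderiv ℝ g (interpolation F θ w) (EuclideanSpace.single j (1 : ℝ))) :=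
    fun j => (hF j).polyGrowth.comp_inl.mul (hG j)
  have hZG : ∀ j, PolyGrowth (fun w => w (Sum.inr j) *
      fderiv ℝ g (interpolation F θ w) (EuclideanSpace.single j (1 : ℝ))) :=
    fun j => (PolyGrowth.coord _).mul (hG j)
  have hHT : ∀ j, PolyGrowth (fun w => Real.sin θ * ∑ i, fderiv ℝ (fderiv ℝ g)
      (interpolation F θ w) (EuclideanSpace.single i (1 : ℝ)) (EuclideanSpace.single j (1 : ℝ)) *
          gradientGram ℓ D i j (w ∘ Sum.inl)) :=
    fun j => (PolyGrowth.const _).mul (PolyGrowth.sum _ fun i _ => (hH i j).mul (hT i j))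
  have hZH : ∀ j, PolyGrowth (fun w => Real.cos θ * fderiv ℝ (fderiv ℝ g) (interpolation F θ w)
      (EuclideanSpace.single j (1 : ℝ)) (EuclideanSpace.single j (1 : ℝ))) :=
    fun j => (PolyGrowth.const _).mul (hH j j)
  calc _ = ∫ w, ∑ j, (Real.cos θ * (F j (w ∘ Sum.inl) *
            fderiv ℝ g (interpolation F θ w) (EuclideanSpace.single j (1 : ℝ))) -
          Real.sin θ * (w (Sum.inr j) *
            fderiv ℝ g (interpolation F θ w) (EuclideanSpace.single j (1 : ℝ))))
          ∂(stdNormalPi (V ⊕ J)) := by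
        refine integral_congr_ae (Filter.Eventually.of_forall fun w => ?_)
        simp only [map_sum, map_smul, smul_eq_mul]
        exact Finset.sum_congr rfl fun j _ => by ring
    _ = ∑ j, (Real.cos θ * ∫ w, F j (w ∘ Sum.inl) *
            fderiv ℝ g (interpolation F θ w) (EuclideanSpace.single j (1 : ℝ))
            ∂(stdNormalPi (V ⊕ J)) -
          Real.sin θ * ∫ w, w (Sum.inr j) *
            fderiv ℝ g (interpolation F θ w) (EuclideanSpace.single j (1 : ℝ))
            ∂(stdNormalPi (V ⊕ J))) := by
        rw [integral_finsetSum _ (by exact fun j _ => (((hFG j).integrable.const_mul _).sub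
          ((hZG j).integrable.const_mul _)))]
        refine Finset.sum_congr rfl fun j _ => ?_
        rw [integral_sub ((hFG j).integrable.const_mul _) ((hZG j).integrable.const_mul _),
          integral_const_mul, integral_const_mul]
    _ = ∫ w, ∑ j, (Real.cos θ * (Real.sin θ * ∑ i, fderiv ℝ (fderiv ℝ g)
          (interpolation F θ w) (EuclideanSpace.single i (1 : ℝ))
            (EuclideanSpace.single j (1 : ℝ)) * gradientGram ℓ D i j (w ∘ Sum.inl)) -
          Real.sin θ * (Real.cos θ * fderiv ℝ (fderiv ℝ g) (interpolation F θ w)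
            (EuclideanSpace.single j (1 : ℝ)) (EuclideanSpace.single j (1 : ℝ))))
          ∂(stdNormalPi (V ⊕ J)) := by
        rw [integral_finsetSum _ (by exact fun j _ => (((hHT j).integrable.const_mul _).sub
          ((hZH j).integrable.const_mul _)))]
        refine Finset.sum_congr rfl fun j _ => ?_
        rw [h1, h2, integral_sub ((hHT j).integrable.const_mul _)
          ((hZH j).integrable.const_mul _)]
        simp only [integral_const_mul]
    _ = _ := by
        refine integral_congr_ae (Filter.Eventually.of_forall fun w => ?_)
        simp only
        rw [Finset.sum_comm, Finset.mul_sum]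
        refine Finset.sum_congr rfl fun j _ => ?_
        simp only [mul_sub, Finset.sum_sub_distrib, mul_ite, mul_one, mul_zero,
          Finset.sum_ite_eq', Finset.mem_univ, if_true]
        ring

/-- **Gaussian approximation through the second derivative.** The distance between a vector of
homogeneous multiaffine functions of Gaussian variables and the standard Gaussian vector is
controlled by the mean deviation of the gradient Gram matrix from the identity. -/
theorem abs_integral_sub_integral_stdGaussian_le (hg : ContDiff ℝ 2 g)
    (hM : ∀ v, ‖fderiv ℝ (fderiv ℝ g) v‖ ≤ M)
    (hF : ∀ j, IsMultiaffineHomogeneous (ℓ j) (F j) (D j)) (hℓ : ∀ j, ℓ j ≠ 0) :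
    |∫ y, g (WithLp.toLp 2 fun j => F j y) ∂(stdNormalPi V) -
        ∫ z, g z ∂(stdGaussian (EuclideanSpace ℝ J))| ≤
      Real.pi / 2 * (M * ∑ i, ∑ j, ∫ y, |gradientGram ℓ D i j y - if i = j then 1 else 0|
        ∂(stdNormalPi V)) := by
  have hM0 : 0 ≤ M := le_trans (norm_nonneg (fderiv ℝ (fderiv ℝ g) 0)) (hM 0)
  have hTd : ∀ i j, PolyGrowth (fun y => gradientGram ℓ D i j y - if i = j then 1 else 0) :=
    fun i j => by
      simpa [sub_eq_add_neg] using (polyGrowth_gradientGram hF i j).add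
        (PolyGrowth.const (-if i = j then (1 : ℝ) else 0))
  have hd := hasDerivAt_integral_interpolation hg hM hF
  have hmv := norm_image_sub_le_of_norm_deriv_le_segment' (a := 0) (b := Real.pi / 2)
    (C := M * ∑ i, ∑ j, ∫ y, |gradientGram ℓ D i j y - if i = j then 1 else 0| ∂(stdNormalPi V))
    (fun θ _ => (hd θ).hasDerivWithinAt) (fun θ _ => ?_) (Real.pi / 2)
    (Set.right_mem_Icc.2 (by positivity))
  · have e1 : ∀ w : V ⊕ J → ℝ, interpolation F (Real.pi / 2) w =
        WithLp.toLp 2 fun j => F j (w ∘ Sum.inl) := fun w => by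
      simp [interpolation, ← sum_smul_single]
    have e0 : ∀ w : V ⊕ J → ℝ, interpolation F 0 w = WithLp.toLp 2 (w ∘ Sum.inr) := fun w => by
      simp [interpolation, ← sum_smul_single]
    have i1 : ∫ y, g (WithLp.toLp 2 fun j => F j y) ∂(stdNormalPi V) =
        ∫ w, g (interpolation F (Real.pi / 2) w) ∂(stdNormalPi (V ⊕ J)) := by
      simp only [e1]
      exact (integral_comp_inl (f := fun y => g (WithLp.toLp 2 fun j => F j y))
        (hg.continuous.comp ((PiLp.continuous_toLp 2 _).comp
          (continuous_pi fun j => (hF j).polyGrowth.1)))).symm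
    have i0 : ∫ z, g z ∂(stdGaussian (EuclideanSpace ℝ J)) =
        ∫ w, g (interpolation F 0 w) ∂(stdNormalPi (V ⊕ J)) := by
      rw [← map_pi_eq_stdGaussian, integral_map (by fun_prop)
        hg.continuous.aestronglyMeasurable]
      simp only [e0]
      exact (integral_comp_inr (f := fun z => g (WithLp.toLp 2 z))
        (hg.continuous.comp (PiLp.continuous_toLp 2 _))).symm
    rw [i1, i0, ← Real.norm_eq_abs]
    refine hmv.trans (le_of_eq ?_)
    ring
  · rw [integral_fderiv_interpolation hg hM hF hℓ]
    have hint : ∀ i j, Integrable (fun w : V ⊕ J → ℝ => M *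
        |gradientGram ℓ D i j (w ∘ Sum.inl) - if i = j then 1 else 0|) (stdNormalPi (V ⊕ J)) :=
      fun i j => ((PolyGrowth.const M).mul (hTd i j).norm.comp_inl).integrable
    calc _ ≤ ∫ w, ∑ i, ∑ j, M *
          |gradientGram ℓ D i j (w ∘ Sum.inl) - if i = j then 1 else 0|
            ∂(stdNormalPi (V ⊕ J)) := by
          refine norm_integral_le_of_norm_le
            (integrable_finsetSum _ fun i _ => integrable_finsetSum _ fun j _ => hint i j)
            (Filter.Eventually.of_forall fun w => ?_)
          rw [norm_mul, norm_mul]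
          have hsc : ‖Real.sin θ‖ * ‖Real.cos θ‖ ≤ 1 :=
            mul_le_one₀ (Real.abs_sin_le_one θ) (norm_nonneg _) (Real.abs_cos_le_one θ)
          refine (mul_le_of_le_one_left (norm_nonneg _) hsc).trans ?_
          refine (norm_sum_le _ _).trans (Finset.sum_le_sum fun i _ => ?_)
          refine (norm_sum_le _ _).trans (Finset.sum_le_sum fun j _ => ?_)
          rw [norm_mul, Real.norm_eq_abs (_ - _)]
          gcongr
          refine ((fderiv ℝ (fderiv ℝ g) (interpolation F θ w)).le_opNorm₂ _ _).trans ?_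
          simpa using hM _
      _ = M * ∑ i, ∑ j, ∫ w, |gradientGram ℓ D i j (w ∘ Sum.inl) - if i = j then 1 else 0|
            ∂(stdNormalPi (V ⊕ J)) := by
          rw [integral_finsetSum _ fun i _ => integrable_finsetSum _ fun j _ => hint i j,
            Finset.mul_sum]
          refine Finset.sum_congr rfl fun i _ => ?_
          rw [integral_finsetSum _ fun j _ => hint i j, Finset.mul_sum]
          exact Finset.sum_congr rfl fun j _ => integral_const_mul _ _
      _ = _ := by
          congr 1
          refine Finset.sum_congr rfl fun i _ => Finset.sum_congr rfl fun j _ => ?_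
          exact integral_comp_inl (hTd i j).norm.1

end Interpolation

/-! ### Multilinear forms -/

section Forms

variable {V : Type*} [Fintype V] [DecidableEq V]

/-- The multilinear polynomial `∑_T w(T) ∏_{x ∈ T} y_x` with coefficients `w`. -/
def multilinearForm (w : Finset V → ℝ) (y : V → ℝ) : ℝ := ∑ T, w T * ∏ z ∈ T, y z

/-- The derivative of `multilinearForm w` in the coordinate `x`. -/
def multilinearPartial (w : Finset V → ℝ) (x : V) (y : V → ℝ) : ℝ :=
  ∑ T with x ∈ T, w T * ∏ z ∈ T.erase x, y z

theorem polyGrowth_monomial (A : Finset V) : PolyGrowth (fun y : V → ℝ => ∏ z ∈ A, y z) :=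
  PolyGrowth.prod _ fun _ _ => PolyGrowth.coord _

theorem polyGrowth_multilinearForm (w : Finset V → ℝ) : PolyGrowth (multilinearForm w) :=
  PolyGrowth.sum _ fun _ _ => (PolyGrowth.const _).mul (polyGrowth_monomial _)

theorem prod_erase_update (T : Finset V) (x : V) (y : V → ℝ) (t : ℝ) :
    ∏ z ∈ T.erase x, Function.update y x t z = ∏ z ∈ T.erase x, y z :=
  Finset.prod_congr rfl fun _ hz => Function.update_of_ne (Finset.ne_of_mem_erase hz) _ _

theorem isMultiaffineHomogeneous_multilinearForm {w : Finset V → ℝ} {ℓ : ℕ}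
    (hw : ∀ T, w T ≠ 0 → T.card = ℓ) :
    IsMultiaffineHomogeneous (ℓ : ℝ) (multilinearForm w) (multilinearPartial w) where
  polyGrowth := polyGrowth_multilinearForm w
  polyGrowth_deriv x :=
    PolyGrowth.sum _ fun _ _ => (PolyGrowth.const _).mul (polyGrowth_monomial _)
  hasDerivAt x y := by
    unfold multilinearForm multilinearPartial
    rw [Finset.sum_filter]
    refine HasDerivAt.fun_sum fun T _ => ?_
    split_ifs with hx
    · simp only [← Finset.mul_prod_erase T _ hx, Function.update_self, prod_erase_update]
      have := ((hasDerivAt_id (y x)).mul_const (∏ z ∈ T.erase x, y z)).const_mul (w T)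
      simpa using this
    · have : ∀ t, ∏ z ∈ T, Function.update y x t z = ∏ z ∈ T, y z := fun t => by
        simpa [Finset.erase_eq_of_notMem hx] using prod_erase_update T x y t
      simp only [this]
      exact hasDerivAt_const _ _
  deriv_update x y t := by simp only [multilinearPartial, prod_erase_update]
  euler y := by
    simp only [multilinearPartial, multilinearForm, Finset.mul_sum, Finset.sum_filter]
    rw [Finset.sum_comm]
    refine Finset.sum_congr rfl fun T _ => ?_
    simp only [mul_ite, mul_zero]
    rw [← Finset.sum_filter, Finset.filter_mem_eq_inter, Finset.univ_inter]
    have : ∀ x ∈ T, y x * (w T * ∏ z ∈ T.erase x, y z) = w T * ∏ z ∈ T, y z := fun x hx => by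
      rw [← Finset.mul_prod_erase T _ hx]; ring
    rw [Finset.sum_congr rfl this, Finset.sum_const, nsmul_eq_mul]
    by_cases h0 : w T = 0
    · simp [h0]
    · rw [hw T h0]

end Forms

/-! ### Gaussian moments of monomials -/

/-- The moments of a standard normal variable. -/
noncomputable def gaussianMoment (m : ℕ) : ℝ := ∫ t, t ^ m ∂(gaussianReal 0 1)

theorem integrable_pow_gaussianReal (m : ℕ) : Integrable (fun t : ℝ => t ^ m) (gaussianReal 0 1) := by
  have h : MemLp (fun t : ℝ => t) m (gaussianReal 0 1) :=
    IsGaussian.memLp_id (gaussianReal 0 1) m (ENNReal.natCast_ne_top m)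
  have h2 := h.integrable_norm_pow'
  refine (integrable_norm_iff (by fun_prop)).1 (h2.congr (Filter.Eventually.of_forall fun t => ?_))
  simp

theorem gaussianMoment_add_two (m : ℕ) :
    gaussianMoment (m + 2) = (m + 1) * gaussianMoment m := by
  have h := integral_mul_gaussianReal_eq_integral_deriv (h := fun t => t ^ (m + 1))
    (h' := fun t => (m + 1) * t ^ m) (fun t => by simpa using hasDerivAt_pow (m + 1) t)
    (integrable_pow_gaussianReal _) ((integrable_pow_gaussianReal _).const_mul _)
    (by simpa [← pow_succ'] using integrable_pow_gaussianReal (m + 2))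
  rw [integral_const_mul] at h
  rw [gaussianMoment, gaussianMoment, ← h]
  simp only [← pow_succ']

@[simp] theorem gaussianMoment_zero : gaussianMoment 0 = 1 := by simp [gaussianMoment]

@[simp] theorem gaussianMoment_one : gaussianMoment 1 = 0 := by simp [gaussianMoment]

@[simp] theorem gaussianMoment_two : gaussianMoment 2 = 1 := by
  simpa using gaussianMoment_add_two 0

theorem gaussianMoment_nonneg {m : ℕ} (hm : m ≤ 4) : 0 ≤ gaussianMoment m := by
  have h3 := gaussianMoment_add_two 1
  have h4 := gaussianMoment_add_two 2
  interval_cases m <;> norm_num at * <;> simp [h3, h4]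

theorem gaussianMoment_le {m : ℕ} (hm : m ≤ 4) : gaussianMoment m ≤ 3 ^ m := by
  have h3 := gaussianMoment_add_two 1
  have h4 := gaussianMoment_add_two 2
  interval_cases m <;> norm_num at * <;> norm_num [h3, h4]

section Moments

variable {V : Type*} [Fintype V] [DecidableEq V]

/-- The multiplicity with which `x` occurs in the finite set `A`. -/
def occ (A : Finset V) (x : V) : ℕ := if x ∈ A then 1 else 0

theorem occ_le_one (A : Finset V) (x : V) : occ A x ≤ 1 := by unfold occ; split_ifs <;> simp

theorem sum_occ (A : Finset V) : ∑ x, occ A x = A.card := by simp [occ]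

theorem monomial_eq_prod_pow_occ (A : Finset V) (y : V → ℝ) :
    ∏ z ∈ A, y z = ∏ x, y x ^ occ A x := by
  simp [occ, pow_ite, Finset.prod_ite_mem]

theorem integral_prod_pow (m : V → ℕ) :
    ∫ y, ∏ x, y x ^ m x ∂(stdNormalPi V) = ∏ x, gaussianMoment (m x) :=
  integral_fintype_prod_eq_prod (f := fun x t => t ^ m x)

/-- Distinct multilinear monomials are orthonormal. -/
theorem integral_monomial_mul (A B : Finset V) :
    ∫ y, (∏ z ∈ A, y z) * ∏ z ∈ B, y z ∂(stdNormalPi V) = if A = B then 1 else 0 := by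
  simp only [monomial_eq_prod_pow_occ A, monomial_eq_prod_pow_occ B, ← Finset.prod_mul_distrib, ← pow_add]
  rw [integral_prod_pow]
  split_ifs with h
  · subst h
    refine Finset.prod_eq_one fun x _ => ?_
    unfold occ
    split_ifs <;> simp
  · obtain ⟨x, hx⟩ : ∃ x, ¬ (x ∈ A ↔ x ∈ B) := by
      by_contra! hc
      exact h (Finset.ext hc)
    refine Finset.prod_eq_zero (Finset.mem_univ x) ?_
    by_cases hA : x ∈ A <;> by_cases hB : x ∈ B <;> simp_all [occ]

theorem integral_monomial (A : Finset V) :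
    ∫ y, ∏ z ∈ A, y z ∂(stdNormalPi V) = if A = ∅ then 1 else 0 := by
  simpa using integral_monomial_mul A ∅

theorem integral_multilinearForm_mul (w v : Finset V → ℝ) :
    ∫ y, multilinearForm w y * multilinearForm v y ∂(stdNormalPi V) = ∑ T, w T * v T := by
  simp only [multilinearForm, Finset.sum_mul_sum]
  have hi : ∀ S T : Finset V, PolyGrowth (fun y : V → ℝ =>
      (w S * ∏ z ∈ S, y z) * (v T * ∏ z ∈ T, y z)) := fun S T =>
    ((PolyGrowth.const _).mul (polyGrowth_monomial _)).mul
      ((PolyGrowth.const _).mul (polyGrowth_monomial _))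
  rw [integral_finsetSum _ fun S _ => (PolyGrowth.sum _ fun T _ => hi S T).integrable]
  refine Finset.sum_congr rfl fun S _ => ?_
  rw [integral_finsetSum _ fun T _ => (hi S T).integrable]
  simp_rw [mul_mul_mul_comm (w S), integral_const_mul, integral_monomial_mul]
  simp

theorem integral_multilinearForm (w : Finset V → ℝ) :
    ∫ y, multilinearForm w y ∂(stdNormalPi V) = w ∅ := by
  simp only [multilinearForm]
  rw [integral_finsetSum _ fun T _ =>
    ((PolyGrowth.const (w T)).mul (polyGrowth_monomial T)).integrable]
  simp_rw [integral_const_mul, integral_monomial]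
  simp

/-- Four finite sets are linked when each of their points lies in at least two of them, and one
of the first two meets one of the last two. -/
def Linked (A B C D : Finset V) : Prop :=
  A ⊆ B ∪ C ∪ D ∧ B ⊆ A ∪ C ∪ D ∧ C ⊆ A ∪ B ∪ D ∧ D ⊆ A ∪ B ∪ C ∧ ¬ Disjoint (A ∪ B) (C ∪ D)

/-- The covariance of two products of monomials is bounded, and it is positive only for linked
quadruples: a point covered exactly once kills the mixed moment, and products over disjoint sets
of variables are independent. -/
theorem covariance_monomial_le (A B C D : Finset V) :
    ∫ y, ((∏ z ∈ A, y z) * ∏ z ∈ B, y z) * ((∏ z ∈ C, y z) * ∏ z ∈ D, y z) ∂(stdNormalPi V) -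
      (∫ y, (∏ z ∈ A, y z) * ∏ z ∈ B, y z ∂(stdNormalPi V)) *
        ∫ y, (∏ z ∈ C, y z) * ∏ z ∈ D, y z ∂(stdNormalPi V) ≤
      open scoped Classical in
      if Linked A B C D then 3 ^ (A.card + B.card + C.card + D.card) else 0 := by
  classical
  have hnn : 0 ≤ (∫ y, (∏ z ∈ A, y z) * ∏ z ∈ B, y z ∂(stdNormalPi V)) *
        ∫ y, (∏ z ∈ C, y z) * ∏ z ∈ D, y z ∂(stdNormalPi V) := by
    rw [integral_monomial_mul, integral_monomial_mul]
    positivity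
  have h4 : ∀ x, occ A x + occ B x + (occ C x + occ D x) ≤ 4 := fun x => by
    have := occ_le_one A x
    have := occ_le_one B x
    have := occ_le_one C x
    have := occ_le_one D x
    omega
  have hE : ∫ y, ((∏ z ∈ A, y z) * ∏ z ∈ B, y z) * ((∏ z ∈ C, y z) * ∏ z ∈ D, y z)
      ∂(stdNormalPi V) = ∏ x, gaussianMoment (occ A x + occ B x + (occ C x + occ D x)) := by
    simp only [monomial_eq_prod_pow_occ A, monomial_eq_prod_pow_occ B,
        monomial_eq_prod_pow_occ C, monomial_eq_prod_pow_occ D, ← Finset.prod_mul_distrib, ← pow_add]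
    rw [integral_prod_pow]
  split_ifs with hL
  · refine (sub_le_self _ hnn).trans ?_
    rw [hE, ← sum_occ A, ← sum_occ B, ← sum_occ C, ← sum_occ D, ← Finset.sum_add_distrib,
      ← Finset.sum_add_distrib, ← Finset.sum_add_distrib, ← Finset.prod_pow_eq_pow_sum]
    refine Finset.prod_le_prod (fun x _ => gaussianMoment_nonneg (h4 x)) fun x _ => ?_
    simpa [add_assoc] using gaussianMoment_le (h4 x)
  · by_cases hdisj : Disjoint (A ∪ B) (C ∪ D)
    · refine le_of_eq (sub_eq_zero.2 ?_)
      rw [hE]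
      simp only [monomial_eq_prod_pow_occ A, monomial_eq_prod_pow_occ B,
        monomial_eq_prod_pow_occ C, monomial_eq_prod_pow_occ D, ← Finset.prod_mul_distrib, ← pow_add]
      rw [integral_prod_pow, integral_prod_pow, ← Finset.prod_mul_distrib]
      refine Finset.prod_congr rfl fun x _ => ?_
      by_cases hx : x ∈ A ∪ B
      · have : x ∉ C ∪ D := Finset.disjoint_left.1 hdisj hx
        simp only [Finset.mem_union, not_or] at this
        simp [occ, this]
      · simp only [Finset.mem_union, not_or] at hx
        simp [occ, hx]
    · obtain ⟨x, hx⟩ : ∃ x, occ A x + occ B x + (occ C x + occ D x) = 1 := by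
        by_contra! hc
        refine hL ⟨?_, ?_, ?_, ?_, hdisj⟩ <;> intro x hx <;> have := hc x <;>
          simp only [Finset.mem_union] <;> by_contra! hn <;> simp_all [occ]
      rw [hE, Finset.prod_eq_zero (Finset.mem_univ x) (by rw [hx, gaussianMoment_one])]
      linarith

end Moments

/-! ### Counting linked quadruples -/

section Counting

variable {V : Type*} [Fintype V] [DecidableEq V]

/-- Nonnegative weights on the subsets of `V` of size between `3` and `k`, such that the sets
through any two given points have total weight at most `κ`. -/
structure IsPairSparse (w : Finset V → ℝ) (k : ℕ) (κ : ℝ) : Prop where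
  bound_nonneg : 0 ≤ κ
  nonneg : ∀ T, 0 ≤ w T
  three_le_card : ∀ T, w T ≠ 0 → 3 ≤ T.card
  card_le : ∀ T, w T ≠ 0 → T.card ≤ k
  sum_pair_le : ∀ x z, x ≠ z → ∑ T with x ∈ T ∧ z ∈ T, w T ≤ κ

theorem exists_ne_of_two_le_card_inter {T U : Finset V} (h : 2 ≤ (T ∩ U).card) :
    ∃ x ∈ T, ∃ z ∈ T, x ∈ U ∧ z ∈ U ∧ x ≠ z := by
  obtain ⟨x, hx, z, hz, hne⟩ := Finset.one_lt_card.1 h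
  simp only [Finset.mem_inter] at hx hz
  exact ⟨x, hx.1, z, hz.1, hx.2, hz.2, hne⟩

theorem two_le_card_inter {T U : Finset V} {x z : V} (hxT : x ∈ T) (hzT : z ∈ T) (hxU : x ∈ U)
    (hzU : z ∈ U) (hne : x ≠ z) : 2 ≤ (T ∩ U).card :=
  Finset.one_lt_card.2 ⟨x, Finset.mem_inter.2 ⟨hxT, hxU⟩, z, Finset.mem_inter.2 ⟨hzT, hzU⟩, hne⟩

/-- A union bound for weighted sums. -/
theorem sum_filter_le_sum_sum {α β : Type*} [Fintype α] (w : α → ℝ) (hw : ∀ a, 0 ≤ w a)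
    (p : α → Prop) [DecidablePred p] (s : Finset β) (q : β → α → Prop)
    [∀ b, DecidablePred (q b)] (h : ∀ a, w a ≠ 0 → p a → ∃ b ∈ s, q b a) :
    ∑ a with p a, w a ≤ ∑ b ∈ s, ∑ a with q b a, w a := by
  simp only [Finset.sum_filter]
  rw [Finset.sum_comm]
  refine Finset.sum_le_sum fun a _ => ?_
  have hnn : ∀ b ∈ s, 0 ≤ if q b a then w a else 0 := fun b _ => by
    split_ifs
    exacts [hw a, le_rfl]
  by_cases h0 : w a = 0
  · simp [h0]
  split_ifs with hp
  · obtain ⟨b, hb, hq⟩ := h a h0 hp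
    refine le_trans ?_ (Finset.single_le_sum hnn hb)
    rw [if_pos hq]
  · exact Finset.sum_nonneg hnn

namespace IsPairSparse

variable {w : Finset V → ℝ} {k : ℕ} {κ : ℝ}

theorem sum_two_le_card_inter_le (hw : IsPairSparse w k κ) (U : Finset V) :
    ∑ T with 2 ≤ (T ∩ U).card, w T ≤ (U.card : ℝ) ^ 2 * κ := by
  refine (sum_filter_le_sum_sum w hw.nonneg _ U.offDiag (fun b T => b.1 ∈ T ∧ b.2 ∈ T)
    fun T _ hT => ?_).trans ?_
  · obtain ⟨x, hx, z, hz, hxU, hzU, hne⟩ := exists_ne_of_two_le_card_inter hT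
    exact ⟨(x, z), by simp [*], hx, hz⟩
  · refine (Finset.sum_le_card_nsmul _ _ κ fun b hb =>
      hw.sum_pair_le _ _ (Finset.mem_offDiag.1 hb).2.2).trans ?_
    rw [nsmul_eq_mul]
    refine mul_le_mul_of_nonneg_right ?_ hw.bound_nonneg
    rw [Finset.offDiag_card, sq]
    exact_mod_cast Nat.sub_le _ _

theorem sum_mem_le (hw : IsPairSparse w k κ) (x : V) :
    ∑ T with x ∈ T, w T ≤ Fintype.card V * κ := by
  refine (sum_filter_le_sum_sum w hw.nonneg _ (Finset.univ.erase x) (fun z T => x ∈ T ∧ z ∈ T)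
    fun T h0 hT => ?_).trans ?_
  · have h3 := hw.three_le_card T h0
    obtain ⟨z, hz, hne⟩ := Finset.exists_mem_ne (s := T) (by omega) x
    exact ⟨z, by simp [hne], hT, hz⟩
  · refine (Finset.sum_le_card_nsmul _ _ κ fun z hz =>
      hw.sum_pair_le _ _ (Finset.ne_of_mem_erase hz).symm).trans ?_
    rw [nsmul_eq_mul]
    exact mul_le_mul_of_nonneg_right (by exact_mod_cast Finset.card_le_univ _) hw.bound_nonneg

theorem sum_not_disjoint_le (hw : IsPairSparse w k κ) (U : Finset V) :
    ∑ T with ¬ Disjoint T U, w T ≤ U.card * (Fintype.card V * κ) := by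
  refine (sum_filter_le_sum_sum w hw.nonneg _ U (fun x T => x ∈ T)
    fun T _ hT => ?_).trans ?_
  · obtain ⟨x, hx, hxU⟩ := Finset.not_disjoint_iff.1 hT
    exact ⟨x, hxU, hx⟩
  · rw [← nsmul_eq_mul]
    exact Finset.sum_le_card_nsmul _ _ _ fun x _ => hw.sum_mem_le x

theorem sum_le (hw : IsPairSparse w k κ) : ∑ T, w T ≤ (Fintype.card V : ℝ) ^ 2 * κ := by
  have h := sum_filter_le_sum_sum w hw.nonneg (fun _ => True) Finset.univ (fun x T => x ∈ T)
    fun T h0 _ => by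
      have h3 := hw.three_le_card T h0
      obtain ⟨x, hx⟩ := Finset.card_pos.1 (show 0 < T.card by omega)
      exact ⟨x, Finset.mem_univ x, hx⟩
  simp only [Finset.filter_true] at h
  refine h.trans ((Finset.sum_le_card_nsmul _ _ _ fun x _ => hw.sum_mem_le x).trans ?_)
  rw [nsmul_eq_mul, Finset.card_univ]
  exact le_of_eq (by ring)

end IsPairSparse

theorem sum_mul_le_mul {α : Type*} (s : Finset α) {f G : α → ℝ} {A B : ℝ} (hf : ∀ a, 0 ≤ f a)
    (hA : ∑ a ∈ s, f a ≤ A) (hB0 : 0 ≤ B) (hB : ∀ a, f a ≠ 0 → G a ≤ B) :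
    ∑ a ∈ s, f a * G a ≤ A * B := by
  refine le_trans (Finset.sum_le_sum fun a _ => ?_)
    ((Finset.sum_mul s f B).symm.le.trans (mul_le_mul_of_nonneg_right hA hB0))
  by_cases h0 : f a = 0
  · simp [h0]
  · exact mul_le_mul_of_nonneg_left (hB a h0) (hf a)

/-- A weighted sum over quadruples which are chosen one set at a time. -/
theorem sum_sum_sum_sum_le {α : Type*} [Fintype α] {w₁ w₂ w₃ w₄ : α → ℝ}
    (h₁ : ∀ a, 0 ≤ w₁ a) (h₂ : ∀ a, 0 ≤ w₂ a) (h₃ : ∀ a, 0 ≤ w₃ a)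
    (R : α → α → Prop) (S : α → α → α → Prop) (Q : α → α → α → α → Prop)
    [∀ a b, Decidable (R a b)] [∀ a b c, Decidable (S a b c)] [∀ a b c d, Decidable (Q a b c d)]
    {A B C D : ℝ} (hB0 : 0 ≤ B) (hC0 : 0 ≤ C) (hD0 : 0 ≤ D) (hA : ∑ a, w₁ a ≤ A)
    (hB : ∀ a, w₁ a ≠ 0 → ∑ b with R a b, w₂ b ≤ B)
    (hC : ∀ a b, w₁ a ≠ 0 → w₂ b ≠ 0 → ∑ c with S a b c, w₃ c ≤ C)
    (hD : ∀ a b c, w₁ a ≠ 0 → w₂ b ≠ 0 → w₃ c ≠ 0 → ∑ d with Q a b c d, w₄ d ≤ D) :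
    ∑ a, ∑ b, ∑ c, ∑ d, (if R a b ∧ S a b c ∧ Q a b c d then w₁ a * w₂ b * w₃ c * w₄ d else 0) ≤
      A * (B * (C * D)) := by
  have e : ∀ a b c d, (if R a b ∧ S a b c ∧ Q a b c d then w₁ a * w₂ b * w₃ c * w₄ d else 0) =
      w₁ a * ((if R a b then w₂ b else 0) * ((if S a b c then w₃ c else 0) *
        (if Q a b c d then w₄ d else 0))) := by
    intro a b c d
    split_ifs <;> simp_all [mul_assoc]
  simp only [e, ← Finset.mul_sum]
  have hite : ∀ (p : Prop) [Decidable p] (r : ℝ), 0 ≤ r → 0 ≤ if p then r else 0 := by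
    intro p _ r hr
    split_ifs
    exacts [hr, le_rfl]
  refine sum_mul_le_mul _ h₁ hA (by positivity) fun a ha => ?_
  refine sum_mul_le_mul _ (fun b => hite _ _ (h₂ b)) ?_ (by positivity) fun b hb => ?_
  · simpa only [Finset.sum_filter] using hB a ha
  have hb' : w₂ b ≠ 0 := fun h => hb (by simp [h])
  refine sum_mul_le_mul _ (fun c => hite _ _ (h₃ c)) ?_ hD0 fun c hc => ?_
  · simpa only [Finset.sum_filter] using hC a b ha hb'
  have hc' : w₃ c ≠ 0 := fun h => hc (by simp [h])
  simpa only [Finset.sum_filter] using hD a b c ha hb' hc'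

/-- Quadruples in which the second set meets the first, and each of the other two shares two
points with the union of its predecessors. -/
abbrev LooseChain (A B C D : Finset V) : Prop :=
  ¬ Disjoint B A ∧ 2 ≤ (C ∩ (A ∪ B)).card ∧ 2 ≤ (D ∩ (A ∪ B ∪ C)).card

/-- Quadruples in which the second set shares two points with the first, the third meets their
union, and the fourth shares two points with the union of its predecessors. -/
abbrev TightChain (A B C D : Finset V) : Prop :=
  2 ≤ (B ∩ A).card ∧ ¬ Disjoint C (A ∪ B) ∧ 2 ≤ (D ∩ (A ∪ B ∪ C)).card

/-- Quadruples which are chains in one of the four admissible orders. -/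
abbrev Chained (A B C D : Finset V) : Prop :=
  ((LooseChain A B C D ∨ TightChain A B C D) ∨ (LooseChain A B D C ∨ TightChain A B D C)) ∨
    ((LooseChain C D A B ∨ TightChain C D A B) ∨ (LooseChain C D B A ∨ TightChain C D B A))

/-- Adding a common point to the first two and to the last two sets of a linked quadruple
produces a chain. If some set shares two points with the opposite pair, then it and its partner
are determined by that pair up to boundedly many choices. Otherwise each set has a point in common
with its partner besides the one added. -/
theorem chained_of_linked {A B C D : Finset V} {x z : V} (hxA : x ∈ A) (hxB : x ∈ B) (hzC : z ∈ C)
    (hzD : z ∈ D) (hA : 3 ≤ A.card) (hB : 3 ≤ B.card) (hC : 3 ≤ C.card) (hD : 3 ≤ D.card)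
    (h : Linked (A.erase x) (B.erase x) (C.erase z) (D.erase z)) : Chained A B C D := by
  obtain ⟨h1, h2, h3, h4, h5⟩ := h
  -- the partner of a set shares the added point and one further point with the other three
  have partner : ∀ {S T₁ T₂ T₃ : Finset V} {u : V}, 3 ≤ S.card → u ∈ S → u ∈ T₃ →
      S.erase u ⊆ T₁ ∪ T₂ ∪ T₃ → 2 ≤ (S ∩ (T₁ ∪ T₂ ∪ T₃)).card := by
    intro S T₁ T₂ T₃ u hS hu hu' hsub
    obtain ⟨v, hv⟩ := Finset.card_pos.1
      (show 0 < (S.erase u).card by rw [Finset.card_erase_of_mem hu]; omega)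
    exact two_le_card_inter hu (Finset.mem_of_mem_erase hv) (by simp [hu']) (hsub hv)
      (Finset.ne_of_mem_erase hv).symm
  -- a set with at most one point in the opposite pair shares two points with its partner
  have cross : ∀ {S S' U : Finset V} {u : V}, 3 ≤ S.card → u ∈ S → u ∈ S' →
      S.erase u ⊆ U ∪ S' → ¬ 2 ≤ (S ∩ U).card → 2 ≤ (S ∩ S').card := by
    intro S S' U u hS hu hu' hsub hU
    by_contra hc
    have e1 : S.erase u ⊆ (S ∩ U) ∪ ((S ∩ S').erase u) := by
      intro v hv
      have hvS := Finset.mem_of_mem_erase hv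
      have hvu := Finset.ne_of_mem_erase hv
      rcases Finset.mem_union.1 (hsub hv) with hh | hh
      · simp [hvS, hh]
      · simp [hvS, hh, hvu]
    have e2 := (Finset.card_le_card e1).trans (Finset.card_union_le _ _)
    rw [Finset.card_erase_of_mem hu, Finset.card_erase_of_mem (Finset.mem_inter.2 ⟨hu, hu'⟩)] at e2
    omega
  have hAB : ¬ Disjoint B A := Finset.not_disjoint_iff.2 ⟨x, hxB, hxA⟩
  have hCD : ¬ Disjoint D C := Finset.not_disjoint_iff.2 ⟨z, hzD, hzC⟩
  have sA : A.erase x ⊆ C ∪ D ∪ B := h1.trans fun v hv => by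
    simp only [Finset.mem_union, Finset.mem_erase] at hv ⊢; tauto
  have sB : B.erase x ⊆ C ∪ D ∪ A := h2.trans fun v hv => by
    simp only [Finset.mem_union, Finset.mem_erase] at hv ⊢; tauto
  have sC : C.erase z ⊆ A ∪ B ∪ D := h3.trans fun v hv => by
    simp only [Finset.mem_union, Finset.mem_erase] at hv ⊢; tauto
  have sD : D.erase z ⊆ A ∪ B ∪ C := h4.trans fun v hv => by
    simp only [Finset.mem_union, Finset.mem_erase] at hv ⊢; tauto
  by_cases c3 : 2 ≤ (C ∩ (A ∪ B)).card
  · exact Or.inl (Or.inl (Or.inl ⟨hAB, c3, partner hD hzD hzC sD⟩))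
  by_cases c4 : 2 ≤ (D ∩ (A ∪ B)).card
  · exact Or.inl (Or.inr (Or.inl ⟨hAB, c4, partner hC hzC hzD sC⟩))
  by_cases c1 : 2 ≤ (A ∩ (C ∪ D)).card
  · exact Or.inr (Or.inl (Or.inl ⟨hCD, c1, partner hB hxB hxA sB⟩))
  by_cases c2 : 2 ≤ (B ∩ (C ∪ D)).card
  · exact Or.inr (Or.inr (Or.inl ⟨hCD, c2, partner hA hxA hxB sA⟩))
  have tBA : 2 ≤ (B ∩ A).card := cross hB hxB hxA sB c2
  obtain ⟨v, hv, hv'⟩ := Finset.not_disjoint_iff.1 h5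
  have hvAB : v ∈ A ∪ B := by
    simp only [Finset.mem_union, Finset.mem_erase] at hv ⊢; tauto
  simp only [Finset.mem_union, Finset.mem_erase] at hv'
  rcases hv' with ⟨-, hvC⟩ | ⟨-, hvD⟩
  · exact Or.inl (Or.inl (Or.inr ⟨tBA, Finset.not_disjoint_iff.2 ⟨v, hvC, hvAB⟩,
      partner hD hzD hzC sD⟩))
  · exact Or.inl (Or.inr (Or.inr ⟨tBA, Finset.not_disjoint_iff.2 ⟨v, hvD, hvAB⟩,
      partner hC hzC hzD sC⟩))

section ChainSums

variable {w₁ w₂ w₃ w₄ : Finset V → ℝ} {k : ℕ} {κ : ℝ}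

theorem sum_looseChain_le (h₁ : IsPairSparse w₁ k κ) (h₂ : IsPairSparse w₂ k κ)
    (h₃ : IsPairSparse w₃ k κ) (h₄ : IsPairSparse w₄ k κ) :
    ∑ A, ∑ B, ∑ C, ∑ D, (if LooseChain A B C D then w₁ A * w₂ B * w₃ C * w₄ D else 0) ≤
      36 * k ^ 5 * Fintype.card V ^ 3 * κ ^ 4 := by
  have hκ := h₁.bound_nonneg
  refine (sum_sum_sum_sum_le h₁.nonneg h₂.nonneg h₃.nonneg (fun A B => ¬ Disjoint B A)
    (fun A B C => 2 ≤ (C ∩ (A ∪ B)).card) (fun A B C D => 2 ≤ (D ∩ (A ∪ B ∪ C)).card)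
    (A := Fintype.card V ^ 2 * κ) (B := k * (Fintype.card V * κ)) (C := (2 * k) ^ 2 * κ)
    (D := (3 * k) ^ 2 * κ) (by positivity) (by positivity) (by positivity) h₁.sum_le
    (fun A hA => (h₂.sum_not_disjoint_le A).trans ?_)
    (fun A B hA hB => (h₃.sum_two_le_card_inter_le (A ∪ B)).trans ?_)
    (fun A B C hA hB hC => (h₄.sum_two_le_card_inter_le (A ∪ B ∪ C)).trans ?_)).trans
    (le_of_eq (by ring))
  · have := h₁.card_le A hA
    gcongr
  · have h1 := h₁.card_le A hA
    have h2 := h₂.card_le B hB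
    have : ((A ∪ B).card : ℝ) ≤ 2 * k := by
      exact_mod_cast (Finset.card_union_le A B).trans (by omega)
    gcongr
  · have h1 := h₁.card_le A hA
    have h2 := h₂.card_le B hB
    have h3 := h₃.card_le C hC
    have h4 := Finset.card_union_le A B
    have : ((A ∪ B ∪ C).card : ℝ) ≤ 3 * k := by
      exact_mod_cast (Finset.card_union_le (A ∪ B) C).trans (by omega)
    gcongr

theorem sum_tightChain_le (h₁ : IsPairSparse w₁ k κ) (h₂ : IsPairSparse w₂ k κ)
    (h₃ : IsPairSparse w₃ k κ) (h₄ : IsPairSparse w₄ k κ) :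
    ∑ A, ∑ B, ∑ C, ∑ D, (if TightChain A B C D then w₁ A * w₂ B * w₃ C * w₄ D else 0) ≤
      36 * k ^ 5 * Fintype.card V ^ 3 * κ ^ 4 := by
  have hκ := h₁.bound_nonneg
  refine (sum_sum_sum_sum_le h₁.nonneg h₂.nonneg h₃.nonneg (fun A B => 2 ≤ (B ∩ A).card)
    (fun A B C => ¬ Disjoint C (A ∪ B)) (fun A B C D => 2 ≤ (D ∩ (A ∪ B ∪ C)).card)
    (A := Fintype.card V ^ 2 * κ) (B := k ^ 2 * κ) (C := (2 * k) * (Fintype.card V * κ))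
    (D := (3 * k) ^ 2 * κ) (by positivity) (by positivity) (by positivity) h₁.sum_le
    (fun A hA => (h₂.sum_two_le_card_inter_le A).trans ?_)
    (fun A B hA hB => (h₃.sum_not_disjoint_le (A ∪ B)).trans ?_)
    (fun A B C hA hB hC => (h₄.sum_two_le_card_inter_le (A ∪ B ∪ C)).trans ?_)).trans ?_
  · have := h₁.card_le A hA
    gcongr
  · have h1 := h₁.card_le A hA
    have h2 := h₂.card_le B hB
    have : ((A ∪ B).card : ℝ) ≤ 2 * k := by
      exact_mod_cast (Finset.card_union_le A B).trans (by omega)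
    gcongr
  · have h1 := h₁.card_le A hA
    have h2 := h₂.card_le B hB
    have h3 := h₃.card_le C hC
    have h4 := Finset.card_union_le A B
    have : ((A ∪ B ∪ C).card : ℝ) ≤ 3 * k := by
      exact_mod_cast (Finset.card_union_le (A ∪ B) C).trans (by omega)
    gcongr
  · have : 0 ≤ (k : ℝ) ^ 5 * Fintype.card V ^ 3 * κ ^ 4 := by positivity
    nlinarith

theorem sum_ite_or_le {α : Type*} [Fintype α] (p q : α → Prop) [DecidablePred p]
    [DecidablePred q] {f : α → ℝ} (hf : ∀ a, 0 ≤ f a) {X Y : ℝ}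
    (hp : ∑ a, (if p a then f a else 0) ≤ X) (hq : ∑ a, (if q a then f a else 0) ≤ Y) :
    ∑ a, (if p a ∨ q a then f a else 0) ≤ X + Y := by
  refine le_trans ?_ (add_le_add hp hq)
  rw [← Finset.sum_add_distrib]
  refine Finset.sum_le_sum fun a _ => ?_
  have := hf a
  split_ifs <;> simp_all

/-- Chained quadruples have total weight `O(n³ κ⁴)`: of the eight parameters of four sets, each
determined by two of its points, five are forced. -/
theorem sum_chained_le (h₁ : IsPairSparse w₁ k κ) (h₂ : IsPairSparse w₂ k κ)
    (h₃ : IsPairSparse w₃ k κ) (h₄ : IsPairSparse w₄ k κ) :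
    ∑ A, ∑ B, ∑ C, ∑ D, (if Chained A B C D then w₁ A * w₂ B * w₃ C * w₄ D else 0) ≤
      288 * k ^ 5 * Fintype.card V ^ 3 * κ ^ 4 := by
  let f : Finset V × Finset V × Finset V × Finset V → ℝ :=
    fun s => w₁ s.1 * w₂ s.2.1 * w₃ s.2.2.1 * w₄ s.2.2.2
  have hf : ∀ s, 0 ≤ f s := fun s => mul_nonneg (mul_nonneg (mul_nonneg (h₁.nonneg _)
    (h₂.nonneg _)) (h₃.nonneg _)) (h₄.nonneg _)
  have conv : ∀ (p : Finset V → Finset V → Finset V → Finset V → Prop)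
      [∀ A B C D, Decidable (p A B C D)],
      ∑ A, ∑ B, ∑ C, ∑ D, (if p A B C D then w₁ A * w₂ B * w₃ C * w₄ D else 0) =
        ∑ s : Finset V × Finset V × Finset V × Finset V,
          if p s.1 s.2.1 s.2.2.1 s.2.2.2 then f s else 0 := by
    intro p _
    simp only [Fintype.sum_prod_type, f]
  have swapCD : ∀ G : Finset V → Finset V → Finset V → Finset V → ℝ,
      ∑ A, ∑ B, ∑ C, ∑ D, G A B C D = ∑ A, ∑ B, ∑ D, ∑ C, G A B C D := fun G =>
    Finset.sum_congr rfl fun A _ => Finset.sum_congr rfl fun B _ => Finset.sum_comm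
  have swapPairs : ∀ G : Finset V → Finset V → Finset V → Finset V → ℝ,
      ∑ A, ∑ B, ∑ C, ∑ D, G A B C D = ∑ C, ∑ D, ∑ A, ∑ B, G A B C D := by
    intro G
    have e1 : ∀ A, ∑ B, ∑ C, ∑ D, G A B C D = ∑ C, ∑ D, ∑ B, G A B C D := fun A => by
      rw [Finset.sum_comm]
      exact Finset.sum_congr rfl fun C _ => Finset.sum_comm
    simp only [e1]
    rw [Finset.sum_comm]
    exact Finset.sum_congr rfl fun C _ => Finset.sum_comm
  have sum4_congr : ∀ {G G' : Finset V → Finset V → Finset V → Finset V → ℝ},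
      (∀ A B C D, G A B C D = G' A B C D) →
      ∑ A, ∑ B, ∑ C, ∑ D, G A B C D = ∑ A, ∑ B, ∑ C, ∑ D, G' A B C D := fun h => by
    simp only [h]
  have l1 := sum_looseChain_le h₁ h₂ h₃ h₄
  have t1 := sum_tightChain_le h₁ h₂ h₃ h₄
  have l2 : ∑ A, ∑ B, ∑ C, ∑ D, (if LooseChain A B D C then w₁ A * w₂ B * w₃ C * w₄ D else 0) ≤
      36 * k ^ 5 * Fintype.card V ^ 3 * κ ^ 4 := by
    rw [swapCD]
    refine le_of_eq_of_le (sum4_congr fun _ _ _ _ => ?_) (sum_looseChain_le h₁ h₂ h₄ h₃)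
    congr 1
    ring
  have t2 : ∑ A, ∑ B, ∑ C, ∑ D, (if TightChain A B D C then w₁ A * w₂ B * w₃ C * w₄ D else 0) ≤
      36 * k ^ 5 * Fintype.card V ^ 3 * κ ^ 4 := by
    rw [swapCD]
    refine le_of_eq_of_le (sum4_congr fun _ _ _ _ => ?_) (sum_tightChain_le h₁ h₂ h₄ h₃)
    congr 1
    ring
  have l3 : ∑ A, ∑ B, ∑ C, ∑ D, (if LooseChain C D A B then w₁ A * w₂ B * w₃ C * w₄ D else 0) ≤
      36 * k ^ 5 * Fintype.card V ^ 3 * κ ^ 4 := by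
    rw [swapPairs]
    refine le_of_eq_of_le (sum4_congr fun _ _ _ _ => ?_) (sum_looseChain_le h₃ h₄ h₁ h₂)
    congr 1
    ring
  have t3 : ∑ A, ∑ B, ∑ C, ∑ D, (if TightChain C D A B then w₁ A * w₂ B * w₃ C * w₄ D else 0) ≤
      36 * k ^ 5 * Fintype.card V ^ 3 * κ ^ 4 := by
    rw [swapPairs]
    refine le_of_eq_of_le (sum4_congr fun _ _ _ _ => ?_) (sum_tightChain_le h₃ h₄ h₁ h₂)
    congr 1
    ring
  have l4 : ∑ A, ∑ B, ∑ C, ∑ D, (if LooseChain C D B A then w₁ A * w₂ B * w₃ C * w₄ D else 0) ≤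
      36 * k ^ 5 * Fintype.card V ^ 3 * κ ^ 4 := by
    rw [swapPairs, swapCD]
    refine le_of_eq_of_le (sum4_congr fun _ _ _ _ => ?_) (sum_looseChain_le h₃ h₄ h₂ h₁)
    congr 1
    ring
  have t4 : ∑ A, ∑ B, ∑ C, ∑ D, (if TightChain C D B A then w₁ A * w₂ B * w₃ C * w₄ D else 0) ≤
      36 * k ^ 5 * Fintype.card V ^ 3 * κ ^ 4 := by
    rw [swapPairs, swapCD]
    refine le_of_eq_of_le (sum4_congr fun _ _ _ _ => ?_) (sum_tightChain_le h₃ h₄ h₂ h₁)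
    congr 1
    ring
  rw [conv] at l1 l2 l3 l4 t1 t2 t3 t4 ⊢
  refine (sum_ite_or_le _ _ hf (sum_ite_or_le _ _ hf (sum_ite_or_le _ _ hf l1 t1)
    (sum_ite_or_le _ _ hf l2 t2)) (sum_ite_or_le _ _ hf (sum_ite_or_le _ _ hf l3 t3)
    (sum_ite_or_le _ _ hf l4 t4))).trans (le_of_eq (by ring))

end ChainSums

end Counting

/-! ### Concentration of the gradient pairings -/

section Concentration

variable {V : Type*} [Fintype V] [DecidableEq V]

/-- A bound on the second moment bounds the first absolute moment. -/
theorem integral_abs_le_sqrt {f : (V → ℝ) → ℝ} (hf : PolyGrowth f) {B : ℝ} (hB : 0 < B)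
    (h : ∫ y, f y ^ 2 ∂(stdNormalPi V) ≤ B) : ∫ y, |f y| ∂(stdNormalPi V) ≤ √B := by
  have hs : 0 < √B := Real.sqrt_pos.2 hB
  have h1 : ∀ y, |f y| ≤ (2 * √B)⁻¹ * f y ^ 2 + √B / 2 := by
    intro y
    have h2 : 0 ≤ (2 * √B)⁻¹ * (|f y| - √B) ^ 2 := by positivity
    have h3 : (2 * √B)⁻¹ * (|f y| - √B) ^ 2 = (2 * √B)⁻¹ * f y ^ 2 + √B / 2 - |f y| := by
      rw [sub_sq, sq_abs]
      field_simp
      ring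
    linarith
  have hi : Integrable (fun y => (2 * √B)⁻¹ * f y ^ 2) (stdNormalPi V) :=
    (hf.pow 2).integrable.const_mul _
  calc ∫ y, |f y| ∂(stdNormalPi V)
      ≤ ∫ y, ((2 * √B)⁻¹ * f y ^ 2 + √B / 2) ∂(stdNormalPi V) :=
        integral_mono hf.norm.integrable (hi.add (integrable_const _)) h1
    _ = (2 * √B)⁻¹ * (∫ y, f y ^ 2 ∂(stdNormalPi V)) + √B / 2 := by
        rw [integral_add hi (integrable_const _), integral_const_mul]
        simp
    _ ≤ (2 * √B)⁻¹ * B + √B / 2 := by gcongr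
    _ = √B := by
        nth_rewrite 2 [← Real.sq_sqrt hB.le]
        field_simp
        ring

theorem integral_sum_mul {σ : Type*} [Fintype σ] (c : σ → ℝ) {m : σ → (V → ℝ) → ℝ}
    (hm : ∀ s, PolyGrowth (m s)) :
    ∫ y, ∑ s, c s * m s y ∂(stdNormalPi V) = ∑ s, c s * ∫ y, m s y ∂(stdNormalPi V) := by
  rw [integral_finsetSum _ fun s _ => (hm s).integrable.const_mul _]
  simp only [integral_const_mul]

theorem integral_sum_mul_sq {σ : Type*} [Fintype σ] (c : σ → ℝ) {m : σ → (V → ℝ) → ℝ}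
    (hm : ∀ s, PolyGrowth (m s)) :
    ∫ y, (∑ s, c s * m s y) ^ 2 ∂(stdNormalPi V) =
      ∑ s, ∑ t, c s * c t * ∫ y, m s y * m t y ∂(stdNormalPi V) := by
  have e : ∀ y, (∑ s, c s * m s y) ^ 2 = ∑ s, c s * ∑ t, c t * (m s y * m t y) := by
    intro y
    rw [sq, Finset.sum_mul_sum]
    refine Finset.sum_congr rfl fun s _ => ?_
    rw [Finset.mul_sum]
    exact Finset.sum_congr rfl fun t _ => by ring
  simp only [e]
  rw [integral_sum_mul c (m := fun s y => ∑ t, c t * (m s y * m t y)) fun s =>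
    PolyGrowth.sum _ fun t _ => (PolyGrowth.const _).mul ((hm s).mul (hm t))]
  refine Finset.sum_congr rfl fun s _ => ?_
  rw [integral_sum_mul c (m := fun t y => m s y * m t y) fun t => (hm s).mul (hm t),
    Finset.mul_sum]
  exact Finset.sum_congr rfl fun t _ => by ring

/-- The inner product `⟨∇F, ∇G⟩` of the gradients of two multilinear forms. -/
def gradientPairing (w v : Finset V → ℝ) (y : V → ℝ) : ℝ :=
  ∑ x, multilinearPartial w x y * multilinearPartial v x y

theorem polyGrowth_multilinearPartial (w : Finset V → ℝ) (x : V) :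
    PolyGrowth (multilinearPartial w x) :=
  PolyGrowth.sum _ fun _ _ => (PolyGrowth.const _).mul (polyGrowth_monomial _)

theorem polyGrowth_gradientPairing (w v : Finset V → ℝ) : PolyGrowth (gradientPairing w v) :=
  PolyGrowth.sum _ fun x _ =>
    (polyGrowth_multilinearPartial w x).mul (polyGrowth_multilinearPartial v x)

theorem gradientPairing_comm (w v : Finset V → ℝ) (y : V → ℝ) :
    gradientPairing w v y = gradientPairing v w y :=
  Finset.sum_congr rfl fun _ _ => mul_comm _ _

/-- The coefficient of the pair `(A, B)` of sets marked at a common point in the expansion of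
`gradientPairing`. -/
def pairCoeff (w v : Finset V → ℝ) (s : Finset V × Finset V × V) : ℝ :=
  if s.2.2 ∈ s.1 ∧ s.2.2 ∈ s.2.1 then w s.1 * v s.2.1 else 0

/-- The product of monomials belonging to a pair of sets marked at a common point. -/
def pairMonomial (s : Finset V × Finset V × V) (y : V → ℝ) : ℝ :=
  (∏ z ∈ s.1.erase s.2.2, y z) * ∏ z ∈ s.2.1.erase s.2.2, y z

theorem polyGrowth_pairMonomial (s : Finset V × Finset V × V) : PolyGrowth (pairMonomial s) :=
  (polyGrowth_monomial _).mul (polyGrowth_monomial _)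

theorem gradientPairing_eq_sum (w v : Finset V → ℝ) (y : V → ℝ) :
    gradientPairing w v y = ∑ s, pairCoeff w v s * pairMonomial s y := by
  simp only [gradientPairing, multilinearPartial, Finset.sum_filter, Fintype.sum_prod_type,
    Finset.sum_mul_sum]
  rw [Finset.sum_comm]
  refine Finset.sum_congr rfl fun A _ => ?_
  rw [Finset.sum_comm]
  refine Finset.sum_congr rfl fun B _ => Finset.sum_congr rfl fun x _ => ?_
  simp only [pairCoeff, pairMonomial]
  split_ifs <;> simp_all
  ring

theorem integral_gradientPairing {w v : Finset V → ℝ} {ℓ : ℕ} (hv : ∀ T, v T ≠ 0 → T.card = ℓ) :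
    ∫ y, gradientPairing w v y ∂(stdNormalPi V) = ℓ * ∑ T, w T * v T := by
  simp only [gradientPairing_eq_sum]
  rw [integral_sum_mul _ polyGrowth_pairMonomial]
  simp only [pairMonomial, integral_monomial_mul, pairCoeff, Fintype.sum_prod_type]
  rw [Finset.mul_sum]
  refine Finset.sum_congr rfl fun A _ => ?_
  have e : ∀ B x, ((if x ∈ A ∧ x ∈ B then w A * v B else 0) *
      if A.erase x = B.erase x then 1 else 0) =
        if x ∈ A then (if B = A then w A * v A else 0) else 0 := by
    intro B x
    by_cases hA : x ∈ A <;> by_cases hB : x ∈ B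
    · by_cases hAB : B = A
      · subst hAB; simp [hA]
      · have : A.erase x ≠ B.erase x := fun h => hAB (by
          rw [← Finset.insert_erase hA, ← Finset.insert_erase hB, h])
        simp [hAB, this]
    · have : B ≠ A := fun h => hB (h ▸ hA)
      simp [hA, hB, this]
    · simp [hA]
    · simp [hA]
  simp only [e]
  rw [Finset.sum_comm]
  simp only [Finset.sum_ite_irrel, Finset.sum_ite_eq', Finset.mem_univ, if_true,
    Finset.sum_const_zero, Finset.sum_ite_mem, Finset.univ_inter, Finset.sum_const, nsmul_eq_mul]
  by_cases h0 : v A = 0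
  · simp [h0]
  · rw [hv A h0]

variable {w v : Finset V → ℝ} {k : ℕ} {κ : ℝ}

theorem pairCoeff_nonneg (hw : ∀ T, 0 ≤ w T) (hv : ∀ T, 0 ≤ v T) (s : Finset V × Finset V × V) :
    0 ≤ pairCoeff w v s := by
  unfold pairCoeff
  split_ifs
  exacts [mul_nonneg (hw _) (hv _), le_rfl]

/-- Each pair of sets of size at most `k` has at most `k` markings. -/
theorem sum_pairCoeff_mul_le (hw : IsPairSparse w k κ) (hv : ∀ T, 0 ≤ v T)
    {G : Finset V → Finset V → ℝ} (hG : ∀ A B, 0 ≤ G A B) :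
    ∑ s, pairCoeff w v s * G s.1 s.2.1 ≤ k * ∑ A, ∑ B, w A * v B * G A B := by
  simp only [Fintype.sum_prod_type, Finset.mul_sum]
  refine Finset.sum_le_sum fun A _ => Finset.sum_le_sum fun B _ => ?_
  rw [← Finset.sum_mul, ← mul_assoc]
  refine mul_le_mul_of_nonneg_right ?_ (hG A B)
  by_cases h0 : w A = 0
  · simp [pairCoeff, h0]
  have hnn : 0 ≤ w A * v B := mul_nonneg (hw.nonneg A) (hv B)
  calc ∑ x, pairCoeff w v (A, B, x) ≤ ∑ x, if x ∈ A then w A * v B else 0 := by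
        refine Finset.sum_le_sum fun x _ => ?_
        simp only [pairCoeff]
        split_ifs <;> simp_all
    _ = A.card * (w A * v B) := by simp
    _ ≤ k * (w A * v B) := by
        have := hw.card_le A h0
        gcongr

/-- The variance of the gradient pairing of two sparse forms is `O(n³ κ⁴)`. -/
theorem variance_gradientPairing_le (hw : IsPairSparse w k κ) (hv : IsPairSparse v k κ) :
    ∫ y, gradientPairing w v y ^ 2 ∂(stdNormalPi V) -
      (∫ y, gradientPairing w v y ∂(stdNormalPi V)) ^ 2 ≤
        3 ^ (4 * k) * (288 * k ^ 7 * Fintype.card V ^ 3 * κ ^ 4) := by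
  have hc := pairCoeff_nonneg hw.nonneg hv.nonneg
  simp only [gradientPairing_eq_sum]
  rw [integral_sum_mul _ polyGrowth_pairMonomial, integral_sum_mul_sq _ polyGrowth_pairMonomial,
    sq, Finset.sum_mul_sum, ← Finset.sum_sub_distrib]
  have hsupp : ∀ s, pairCoeff w v s ≠ 0 → s.2.2 ∈ s.1 ∧ s.2.2 ∈ s.2.1 ∧ w s.1 ≠ 0 ∧
      v s.2.1 ≠ 0 := by
    intro s hs
    unfold pairCoeff at hs
    split_ifs at hs with h
    · exact ⟨h.1, h.2, left_ne_zero_of_mul hs, right_ne_zero_of_mul hs⟩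
    · exact absurd rfl hs
  have key : ∀ s t : Finset V × Finset V × V,
      pairCoeff w v s * pairCoeff w v t * (∫ y, pairMonomial s y * pairMonomial t y
          ∂(stdNormalPi V)) - pairCoeff w v s * (∫ y, pairMonomial s y ∂(stdNormalPi V)) *
            (pairCoeff w v t * ∫ y, pairMonomial t y ∂(stdNormalPi V)) ≤
        pairCoeff w v s * (pairCoeff w v t *
          (3 ^ (4 * k) * if Chained s.1 s.2.1 t.1 t.2.1 then 1 else 0)) := by
    intro s t
    by_cases h0 : pairCoeff w v s = 0
    · simp [h0]
    by_cases h0' : pairCoeff w v t = 0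
    · simp [h0']
    obtain ⟨hsA, hsB, hwA, hvB⟩ := hsupp s h0
    obtain ⟨htC, htD, hwC, hvD⟩ := hsupp t h0'
    have hcov := covariance_monomial_le (s.1.erase s.2.2) (s.2.1.erase s.2.2)
      (t.1.erase t.2.2) (t.2.1.erase t.2.2)
    have hbound : (open scoped Classical in
        if Linked (s.1.erase s.2.2) (s.2.1.erase s.2.2) (t.1.erase t.2.2) (t.2.1.erase t.2.2)
          then (3 : ℝ) ^ ((s.1.erase s.2.2).card + (s.2.1.erase s.2.2).card +
            (t.1.erase t.2.2).card + (t.2.1.erase t.2.2).card) else 0) ≤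
        3 ^ (4 * k) * if Chained s.1 s.2.1 t.1 t.2.1 then 1 else 0 := by
      split_ifs with hL hCh hCh
      · rw [mul_one]
        refine pow_le_pow_right₀ (by norm_num) ?_
        have a1 := (Finset.card_erase_le (s := s.1) (a := s.2.2)).trans (hw.card_le _ hwA)
        have a2 := (Finset.card_erase_le (s := s.2.1) (a := s.2.2)).trans (hv.card_le _ hvB)
        have a3 := (Finset.card_erase_le (s := t.1) (a := t.2.2)).trans (hw.card_le _ hwC)
        have a4 := (Finset.card_erase_le (s := t.2.1) (a := t.2.2)).trans (hv.card_le _ hvD)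
        omega
      · exact absurd (chained_of_linked hsA hsB htC htD (hw.three_le_card _ hwA)
          (hv.three_le_card _ hvB) (hw.three_le_card _ hwC) (hv.three_le_card _ hvD) hL) hCh
      · positivity
      · simp
    have := mul_le_mul_of_nonneg_left (hcov.trans hbound) (mul_nonneg (hc s) (hc t))
    simp only [pairMonomial] at *
    linarith
  have hG : ∀ A B C D : Finset V, (0 : ℝ) ≤ 3 ^ (4 * k) * if Chained A B C D then 1 else 0 := by
    intro A B C D
    split_ifs <;> simp
  have hwv : ∀ A B, 0 ≤ w A * v B := fun A B => mul_nonneg (hw.nonneg A) (hv.nonneg B)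
  calc _ ≤ ∑ s, ∑ t, pairCoeff w v s * (pairCoeff w v t *
          (3 ^ (4 * k) * if Chained s.1 s.2.1 t.1 t.2.1 then 1 else 0)) := by
        refine Finset.sum_le_sum fun s _ => ?_
        rw [← Finset.sum_sub_distrib]
        exact Finset.sum_le_sum fun t _ => key s t
    _ ≤ ∑ s, pairCoeff w v s * (k * ∑ C, ∑ D, w C * v D *
          (3 ^ (4 * k) * if Chained s.1 s.2.1 C D then 1 else 0)) := by
        refine Finset.sum_le_sum fun s _ => ?_
        rw [← Finset.mul_sum]
        exact mul_le_mul_of_nonneg_left (sum_pairCoeff_mul_le hw hv.nonneg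
          (G := fun C D => 3 ^ (4 * k) * if Chained s.1 s.2.1 C D then 1 else 0)
          fun C D => hG _ _ _ _) (hc s)
    _ ≤ k * ∑ A, ∑ B, w A * v B * (k * ∑ C, ∑ D, w C * v D *
          (3 ^ (4 * k) * if Chained A B C D then 1 else 0)) :=
        sum_pairCoeff_mul_le hw hv.nonneg (G := fun A B => k * ∑ C, ∑ D, w C * v D *
          (3 ^ (4 * k) * if Chained A B C D then 1 else 0)) fun A B =>
          mul_nonneg (Nat.cast_nonneg k) (Finset.sum_nonneg fun C _ => Finset.sum_nonneg fun D _ =>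
            mul_nonneg (hwv C D) (hG _ _ _ _))
    _ = 3 ^ (4 * k) * (k ^ 2 * ∑ A, ∑ B, ∑ C, ∑ D,
          (if Chained A B C D then w A * v B * w C * v D else 0)) := by
        simp only [Finset.mul_sum]
        refine Finset.sum_congr rfl fun A _ => Finset.sum_congr rfl fun B _ =>
          Finset.sum_congr rfl fun C _ => Finset.sum_congr rfl fun D _ => ?_
        split_ifs <;> ring
    _ ≤ 3 ^ (4 * k) * (k ^ 2 * (288 * k ^ 5 * Fintype.card V ^ 3 * κ ^ 4)) := by
        gcongr
        exact sum_chained_le hw hv hw hv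
    _ = _ := by ring

/-- The sum of the partial derivatives of a sparse form has second moment `O(n² κ²)`. Degree at
least three enters here: the sets left after removing a point still have two elements. -/
theorem integral_sum_partial_sq_le (hv : IsPairSparse v k κ) :
    ∫ y, (∑ x, multilinearPartial v x y) ^ 2 ∂(stdNormalPi V) ≤
      k ^ 4 * Fintype.card V ^ 2 * κ ^ 2 := by
  have hκ := hv.bound_nonneg
  let c : Finset V × V → ℝ := fun s => if s.2 ∈ s.1 then v s.1 else 0
  let m : Finset V × V → (V → ℝ) → ℝ := fun s y => ∏ z ∈ s.1.erase s.2, y z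
  have hc : ∀ s, 0 ≤ c s := fun s => by
    simp only [c]
    split_ifs
    exacts [hv.nonneg _, le_rfl]
  have e : ∀ y, ∑ x, multilinearPartial v x y = ∑ s, c s * m s y := by
    intro y
    simp only [multilinearPartial, Finset.sum_filter, Fintype.sum_prod_type, c, m]
    rw [Finset.sum_comm]
    exact Finset.sum_congr rfl fun A _ => Finset.sum_congr rfl fun x _ => by split_ifs <;> simp
  have hmark : ∀ G : Finset V → ℝ, (∀ A, 0 ≤ G A) →
      ∑ s, c s * G s.1 ≤ k * ∑ A, v A * G A := by
    intro G hG
    simp only [Fintype.sum_prod_type, Finset.mul_sum]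
    refine Finset.sum_le_sum fun A _ => ?_
    rw [← Finset.sum_mul, ← mul_assoc]
    refine mul_le_mul_of_nonneg_right ?_ (hG A)
    by_cases h0 : v A = 0
    · simp [c, h0]
    · have h1 := hv.card_le A h0
      have h2 := hv.nonneg A
      simp only [c, Finset.sum_ite_mem, Finset.univ_inter, Finset.sum_const, nsmul_eq_mul]
      gcongr
  simp only [e]
  rw [integral_sum_mul_sq c (m := m) fun s => polyGrowth_monomial _]
  simp only [m, integral_monomial_mul]
  have key : ∀ s t : Finset V × V, c s * c t *
      (if s.1.erase s.2 = t.1.erase t.2 then 1 else 0) ≤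
        c s * (c t * if 2 ≤ (t.1 ∩ s.1).card then 1 else 0) := by
    intro s t
    rw [mul_assoc]
    by_cases h0 : c s = 0
    · simp [h0]
    refine mul_le_mul_of_nonneg_left (mul_le_mul_of_nonneg_left ?_ (hc t)) (hc s)
    split_ifs with h1 h2
    · exact le_rfl
    · refine absurd ?_ h2
      have hs : s.2 ∈ s.1 ∧ v s.1 ≠ 0 := by
        simp only [c] at h0
        split_ifs at h0 with hh
        · exact ⟨hh, h0⟩
        · exact absurd rfl h0
      have h3 := hv.three_le_card _ hs.2
      have h4 : s.1.erase s.2 ⊆ t.1 ∩ s.1 := Finset.subset_inter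
        (h1 ▸ Finset.erase_subset _ _) (Finset.erase_subset _ _)
      have h5 := Finset.card_le_card h4
      rw [Finset.card_erase_of_mem hs.1] at h5
      omega
    · norm_num
    · exact le_rfl
  calc _ ≤ ∑ s, ∑ t, c s * (c t * if 2 ≤ (t.1 ∩ s.1).card then 1 else 0) :=
        Finset.sum_le_sum fun s _ => Finset.sum_le_sum fun t _ => key s t
    _ ≤ ∑ s, c s * (k * ∑ B, v B * if 2 ≤ (B ∩ s.1).card then 1 else 0) := by
        refine Finset.sum_le_sum fun s _ => ?_
        rw [← Finset.mul_sum]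
        refine mul_le_mul_of_nonneg_left (hmark
          (fun B => if 2 ≤ (B ∩ s.1).card then 1 else 0) fun B => ?_) (hc s)
        split_ifs <;> simp
    _ ≤ k * ∑ A, v A * (k * ∑ B, v B * if 2 ≤ (B ∩ A).card then 1 else 0) := by
        refine hmark (fun A => k * ∑ B, v B * if 2 ≤ (B ∩ A).card then 1 else 0) fun A =>
          mul_nonneg (Nat.cast_nonneg k) (Finset.sum_nonneg fun B _ =>
            mul_nonneg (hv.nonneg B) ?_)
        split_ifs <;> simp
    _ ≤ k * ((Fintype.card V ^ 2 * κ) * (k * (k ^ 2 * κ))) := by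
        refine mul_le_mul_of_nonneg_left (sum_mul_le_mul _ hv.nonneg hv.sum_le (by positivity)
          fun A hA => mul_le_mul_of_nonneg_left ?_ (Nat.cast_nonneg k)) (Nat.cast_nonneg k)
        simp only [mul_ite, mul_one, mul_zero]
        rw [← Finset.sum_filter]
        refine (hv.sum_two_le_card_inter_le A).trans ?_
        have := hv.card_le A hA
        gcongr
    _ = _ := by ring

theorem multilinearPartial_of_card_eq_one (hw : ∀ T, w T ≠ 0 → T.card = 1) (x : V) (y : V → ℝ) :
    multilinearPartial w x y = w {x} := by
  unfold multilinearPartial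
  rw [Finset.sum_eq_single {x}]
  · simp
  · intro T hT hne
    by_cases h0 : w T = 0
    · simp [h0]
    · obtain ⟨z, rfl⟩ := Finset.card_eq_one.1 (hw T h0)
      simp only [Finset.mem_filter, Finset.mem_univ, Finset.mem_singleton, true_and] at hT
      exact absurd (by rw [hT]) hne
  · simp

/-- The normalized gradient pairing concentrates around the inner product of the coefficients,
for two sparse forms. -/
theorem integral_abs_gradientPairing_sub_le_of_sparse (hw : IsPairSparse w k κ)
    (hv : IsPairSparse v k κ) {ℓ : ℕ} (hℓ : 1 ≤ ℓ) (hvℓ : ∀ T, v T ≠ 0 → T.card = ℓ) {B : ℝ}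
    (hB : 0 < B) (hle : 3 ^ (4 * k) * (288 * k ^ 7 * Fintype.card V ^ 3 * κ ^ 4) ≤ B) :
    ∫ y, |(ℓ : ℝ)⁻¹ * gradientPairing w v y - ∑ T, w T * v T| ∂(stdNormalPi V) ≤ √B := by
  set δ := ∑ T, w T * v T with hδ
  have hS := polyGrowth_gradientPairing w v
  have hℓ0 : (ℓ : ℝ) ≠ 0 := by positivity
  have hPG : PolyGrowth (fun y => (ℓ : ℝ)⁻¹ * gradientPairing w v y - δ) := by
    simpa [sub_eq_add_neg] using ((PolyGrowth.const _).mul hS).add (PolyGrowth.const (-δ))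
  refine integral_abs_le_sqrt hPG hB ?_
  have hmean := integral_gradientPairing (w := w) hvℓ
  rw [← hδ] at hmean
  have hvar := variance_gradientPairing_le hw hv
  have e : ∀ y, ((ℓ : ℝ)⁻¹ * gradientPairing w v y - δ) ^ 2 =
      (ℓ : ℝ)⁻¹ ^ 2 * gradientPairing w v y ^ 2 -
        (2 * δ * (ℓ : ℝ)⁻¹ * gradientPairing w v y - δ ^ 2) := fun y => by ring
  have i1 : Integrable (fun y => 2 * δ * (ℓ : ℝ)⁻¹ * gradientPairing w v y) (stdNormalPi V) :=
    hS.integrable.const_mul _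
  have i2 : Integrable (fun y => 2 * δ * (ℓ : ℝ)⁻¹ * gradientPairing w v y - δ ^ 2)
      (stdNormalPi V) := i1.sub (integrable_const _)
  simp only [e]
  rw [integral_sub ((hS.pow 2).integrable.const_mul _) i2,
    integral_sub i1 (integrable_const _), integral_const_mul, integral_const_mul, hmean]
  rw [hmean] at hvar
  simp only [integral_const, probReal_univ, one_smul]
  have e2 : (ℓ : ℝ)⁻¹ ^ 2 * ∫ y, gradientPairing w v y ^ 2 ∂(stdNormalPi V) -
      (2 * δ * (ℓ : ℝ)⁻¹ * (ℓ * δ) - δ ^ 2) =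
      (ℓ : ℝ)⁻¹ ^ 2 * (∫ y, gradientPairing w v y ^ 2 ∂(stdNormalPi V) - (ℓ * δ) ^ 2) := by
    field_simp
    ring
  rw [e2]
  have h1 : (ℓ : ℝ)⁻¹ ^ 2 ≤ 1 := by
    refine pow_le_one₀ (by positivity) (inv_le_one_of_one_le₀ (by exact_mod_cast hℓ))
  have h2 : (∫ y, gradientPairing w v y ^ 2 ∂(stdNormalPi V)) - (ℓ * δ) ^ 2 ≤ B := hvar.trans hle
  calc _ ≤ (ℓ : ℝ)⁻¹ ^ 2 * B := by gcongr
    _ ≤ B := mul_le_of_le_one_left hB.le h1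

/-- The gradient pairing of a linear form with constant coefficients and a sparse form is
small. -/
theorem integral_abs_gradientPairing_le_of_linear {c : ℝ} (hw : ∀ T, w T ≠ 0 → T.card = 1)
    (hwc : ∀ x, w {x} = c) (hv : IsPairSparse v k κ) {ℓ : ℕ} (hℓ : 1 ≤ ℓ) {B : ℝ}
    (hB : 0 < B) (hle : c ^ 2 * (k ^ 4 * Fintype.card V ^ 2 * κ ^ 2) ≤ B) :
    ∫ y, |(ℓ : ℝ)⁻¹ * gradientPairing w v y| ∂(stdNormalPi V) ≤ √B := by
  refine integral_abs_le_sqrt ((PolyGrowth.const _).mul (polyGrowth_gradientPairing w v)) hB ?_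
  have e : ∀ y, ((ℓ : ℝ)⁻¹ * gradientPairing w v y) ^ 2 =
      ((ℓ : ℝ)⁻¹ ^ 2 * c ^ 2) * (∑ x, multilinearPartial v x y) ^ 2 := fun y => by
    simp only [gradientPairing, multilinearPartial_of_card_eq_one hw, hwc, ← Finset.mul_sum]
    ring
  simp only [e]
  rw [integral_const_mul]
  have h1 : (ℓ : ℝ)⁻¹ ^ 2 ≤ 1 := by
    refine pow_le_one₀ (by positivity) (inv_le_one_of_one_le₀ (by exact_mod_cast hℓ))
  have h2 := integral_sum_partial_sq_le hv
  have hκ := hv.bound_nonneg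
  calc _ ≤ (1 * c ^ 2) * (k ^ 4 * Fintype.card V ^ 2 * κ ^ 2) := by gcongr
    _ ≤ B := by rwa [one_mul]

end Concentration

/-! ### Arithmetic progressions -/

section Progressions

/-- The parameters `(a, d, S)` of the monomials in the degree `ℓ` component. -/
def apIndex (n k ℓ : ℕ) [NeZero n] : Finset (ZMod n × ℕ × Finset ℕ) :=
  Finset.univ ×ˢ Finset.Icc 1 (n / 2) ×ˢ (Finset.range k).powersetCard ℓ

/-- The set of points `a + i d`, `i ∈ S`, of a progression with parameters `(a, d, S)`. -/
def apPoints (n : ℕ) (p : ZMod n × ℕ × Finset ℕ) : Finset (ZMod n) :=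
  p.2.2.image fun i : ℕ => p.1 + (i : ZMod n) * (p.2.1 : ZMod n)

/-- The number of representations of `T` as the point set of a progression. -/
def apCount (n k ℓ : ℕ) [NeZero n] (T : Finset (ZMod n)) : ℝ :=
  ((apIndex n k ℓ).filter fun p => apPoints n p = T).card

variable {n k ℓ : ℕ} [NeZero n]

theorem mem_apIndex {p : ZMod n × ℕ × Finset ℕ} :
    p ∈ apIndex n k ℓ ↔ (1 ≤ p.2.1 ∧ p.2.1 ≤ n / 2) ∧ p.2.2 ⊆ Finset.range k ∧ p.2.2.card = ℓ := by
  simp [apIndex, Finset.mem_powersetCard]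

/-- Differences of distinct indices below `k` are units modulo `n`. -/
theorem isUnit_natCast_sub (hcop : Nat.Coprime n (k - 1)!) {i j : ℕ} (hij : i < j) (hj : j < k) :
    IsUnit ((j : ZMod n) - i) := by
  rw [← Nat.cast_sub hij.le, ZMod.isUnit_iff_coprime]
  refine (hcop.coprime_dvd_right ?_).symm
  exact Nat.dvd_factorial (by omega) (by omega)

theorem isUnit_natCast_sub_of_ne (hcop : Nat.Coprime n (k - 1)!) {i j : ℕ} (hij : i ≠ j)
    (hi : i < k) (hj : j < k) : IsUnit ((j : ZMod n) - i) := by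
  rcases lt_or_gt_of_ne hij with h | h
  · exact isUnit_natCast_sub hcop h hj
  · rw [← neg_sub]
    exact (isUnit_natCast_sub hcop h hi).neg

theorem natCast_injOn_half {d d' : ℕ} (hn : 1 < n) (hd : d ≤ n / 2) (hd' : d' ≤ n / 2)
    (h : (d : ZMod n) = d') : d = d' := by
  have h1 : d < n := by omega
  have h2 : d' < n := by omega
  have := (ZMod.natCast_eq_natCast_iff' d d' n).1 h
  rwa [Nat.mod_eq_of_lt h1, Nat.mod_eq_of_lt h2] at this

theorem progression_injOn (hn : 1 < n) (hcop : Nat.Coprime n (k - 1)!)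
    {p : ZMod n × ℕ × Finset ℕ} (hp : p ∈ apIndex n k ℓ) :
    Set.InjOn (fun i : ℕ => p.1 + (i : ZMod n) * (p.2.1 : ZMod n)) p.2.2 := by
  obtain ⟨⟨hd1, hd2⟩, hS, -⟩ := mem_apIndex.1 hp
  intro i hi j hj hij
  by_contra hne
  have hu := isUnit_natCast_sub_of_ne hcop hne (Finset.mem_range.1 (hS hi))
    (Finset.mem_range.1 (hS hj))
  have h0 : ((j : ZMod n) - i) * (p.2.1 : ZMod n) = 0 := by
    simp only at hij
    linear_combination -hij
  rw [hu.mul_right_eq_zero] at h0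
  have := natCast_injOn_half (d := p.2.1) (d' := 0) hn hd2 (by omega) (by simpa using h0)
  omega

theorem card_apPoints (hn : 1 < n) (hcop : Nat.Coprime n (k - 1)!)
    {p : ZMod n × ℕ × Finset ℕ} (hp : p ∈ apIndex n k ℓ) : (apPoints n p).card = ℓ := by
  rw [apPoints, Finset.card_image_of_injOn (progression_injOn hn hcop hp)]
  exact (mem_apIndex.1 hp).2.2

theorem sum_apCount_mul (f : Finset (ZMod n) → ℝ) :
    ∑ T, apCount n k ℓ T * f T = ∑ p ∈ apIndex n k ℓ, f (apPoints n p) := by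
  rw [← Finset.sum_fiberwise (apIndex n k ℓ) (apPoints n)]
  refine Finset.sum_congr rfl fun T _ => ?_
  rw [Finset.sum_congr rfl fun p hp => by rw [(Finset.mem_filter.1 hp).2], Finset.sum_const,
    nsmul_eq_mul, apCount]

theorem apSum_eq_multilinearForm (hn : 1 < n) (hcop : Nat.Coprime n (k - 1)!) (y : ZMod n → ℝ) :
    apSum n k ℓ y = multilinearForm (apCount n k ℓ) y := by
  rw [multilinearForm, sum_apCount_mul fun T => ∏ z ∈ T, y z]
  simp only [apSum, apIndex, Finset.sum_product]
  refine Finset.sum_congr rfl fun a _ => Finset.sum_congr rfl fun d hd =>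
    Finset.sum_congr rfl fun S hS => ?_
  have hp : (a, d, S) ∈ apIndex n k ℓ := by
    simp only [apIndex, Finset.mem_product, Finset.mem_univ, true_and]
    exact ⟨hd, hS⟩
  rw [apPoints, Finset.prod_image (progression_injOn hn hcop hp)]

theorem apCount_nonneg (T : Finset (ZMod n)) : 0 ≤ apCount n k ℓ T := Nat.cast_nonneg _

theorem card_eq_of_apCount_ne_zero (hn : 1 < n) (hcop : Nat.Coprime n (k - 1)!)
    {T : Finset (ZMod n)} (hT : apCount n k ℓ T ≠ 0) : T.card = ℓ := by
  obtain ⟨p, hp⟩ := Finset.card_ne_zero.1 fun h => hT (by rw [apCount, h, Nat.cast_zero])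
  obtain ⟨hp', rfl⟩ := Finset.mem_filter.1 hp
  exact card_apPoints hn hcop hp'

theorem apCount_singleton (x : ZMod n) : apCount n k ℓ {x} = apCount n k ℓ {0} := by
  unfold apCount
  congr 1
  have himg : ∀ (t : ZMod n) (p : ZMod n × ℕ × Finset ℕ),
      apPoints n (p.1 + t, p.2) = (apPoints n p).image (· + t) := by
    intro t p
    simp only [apPoints, Finset.image_image]
    exact Finset.image_congr fun i _ => by simp only [Function.comp_apply]; ring
  refine Finset.card_bij' (fun p _ => (p.1 + -x, p.2)) (fun p _ => (p.1 + x, p.2))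
    (fun p hp => ?_) (fun p hp => ?_) (fun p _ => by simp) (fun p _ => by simp)
  · rw [Finset.mem_filter] at hp ⊢
    exact ⟨by have h := mem_apIndex.1 hp.1; exact mem_apIndex.2 h, by rw [himg, hp.2]; simp⟩
  · rw [Finset.mem_filter] at hp ⊢
    exact ⟨by have h := mem_apIndex.1 hp.1; exact mem_apIndex.2 h, by rw [himg, hp.2]; simp⟩

/-- Two points determine a progression once their positions in it are known. -/
theorem sum_apCount_pair_le (hn : 1 < n) (hcop : Nat.Coprime n (k - 1)!) {x z : ZMod n}
    (hxz : x ≠ z) : ∑ T with x ∈ T ∧ z ∈ T, apCount n k ℓ T ≤ k * (k * 2 ^ k) := by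
  have h1 : ∑ T with x ∈ T ∧ z ∈ T, apCount n k ℓ T =
      ((apIndex n k ℓ).filter fun p => x ∈ apPoints n p ∧ z ∈ apPoints n p).card := by
    rw [Finset.sum_filter]
    have := sum_apCount_mul (n := n) (k := k) (ℓ := ℓ)
      fun T => if x ∈ T ∧ z ∈ T then (1 : ℝ) else 0
    simp only [mul_ite, mul_one, mul_zero] at this
    rw [this, Finset.card_filter]
    push_cast
    rfl
  rw [h1]
  let idx : Finset (ℕ × ℕ × Finset ℕ) :=
    Finset.range k ×ˢ Finset.range k ×ˢ (Finset.range k).powerset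
  have hidx : idx.card = k * (k * 2 ^ k) := by simp [idx]
  have hsub : ((apIndex n k ℓ).filter fun p => x ∈ apPoints n p ∧ z ∈ apPoints n p) ⊆
      idx.biUnion fun q => (apIndex n k ℓ).filter fun p => p.2.2 = q.2.2 ∧
        p.1 + (q.1 : ZMod n) * (p.2.1 : ZMod n) = x ∧
          p.1 + (q.2.1 : ZMod n) * (p.2.1 : ZMod n) = z := by
    intro p hp
    obtain ⟨hp, hx, hz⟩ := Finset.mem_filter.1 hp
    obtain ⟨i, hi, hix⟩ := Finset.mem_image.1 hx
    obtain ⟨j, hj, hjz⟩ := Finset.mem_image.1 hz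
    have hS := (mem_apIndex.1 hp).2.1
    refine Finset.mem_biUnion.2 ⟨(i, j, p.2.2), ?_, Finset.mem_filter.2 ⟨hp, rfl, hix, hjz⟩⟩
    simp only [idx, Finset.mem_product, Finset.mem_powerset]
    exact ⟨hS hi, hS hj, hS⟩
  have hone : ∀ q ∈ idx, ((apIndex n k ℓ).filter fun p => p.2.2 = q.2.2 ∧
        p.1 + (q.1 : ZMod n) * (p.2.1 : ZMod n) = x ∧
          p.1 + (q.2.1 : ZMod n) * (p.2.1 : ZMod n) = z).card ≤ 1 := by
    rintro ⟨i, j, S⟩ hq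
    simp only [idx, Finset.mem_product, Finset.mem_range, Finset.mem_powerset] at hq
    rw [Finset.card_le_one]
    rintro ⟨a, d, S₁⟩ h ⟨a', d', S₂⟩ h'
    obtain ⟨hp, e1, e2, e3⟩ := Finset.mem_filter.1 h
    obtain ⟨hp', e1', e2', e3'⟩ := Finset.mem_filter.1 h'
    simp only at e1 e2 e3 e1' e2' e3'
    have hij : i ≠ j := fun hh => hxz (by rw [← e2, ← e3, hh])
    have hu := isUnit_natCast_sub_of_ne hcop hij hq.1 hq.2.1
    have hdd : (d : ZMod n) = d' := by
      refine hu.mul_left_cancel ?_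
      linear_combination e3 - e2 - e3' + e2'
    have hd : d = d' := natCast_injOn_half hn (mem_apIndex.1 hp).1.2 (mem_apIndex.1 hp').1.2 hdd
    have ha : a = a' := by linear_combination e2 - e2' - (i : ZMod n) * hdd
    rw [ha, hd, e1, e1']
  have h2 := (Finset.card_le_card hsub).trans
    (Finset.card_biUnion_le_card_mul idx _ 1 hone)
  rw [mul_one, hidx] at h2
  exact_mod_cast h2

theorem memLp_apSum (hn : 1 < n) (hcop : Nat.Coprime n (k - 1)!) :
    MemLp (apSum n k ℓ) 2 (gaussianInput n) := by
  have h : apSum n k ℓ = multilinearForm (apCount n k ℓ) :=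
    funext (apSum_eq_multilinearForm hn hcop)
  rw [h]
  have hp := polyGrowth_multilinearForm (apCount n k ℓ)
  exact (memLp_two_iff_integrable_sq hp.1.aestronglyMeasurable).2 (hp.pow 2).integrable

/-- The normalizing constant in terms of the representation counts. -/
theorem apSigma_sq (hn : 1 < n) (hcop : Nat.Coprime n (k - 1)!) (hℓ : 1 ≤ ℓ) :
    apSigma n k ℓ ^ 2 = ∑ T, apCount n k ℓ T * apCount n k ℓ T := by
  have h : apSum n k ℓ = multilinearForm (apCount n k ℓ) :=
    funext (apSum_eq_multilinearForm hn hcop)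
  have hempty : apCount n k ℓ ∅ = 0 := by
    by_contra h0
    have := card_eq_of_apCount_ne_zero hn hcop h0
    rw [Finset.card_empty] at this
    omega
  have hmean : ∫ y, apSum n k ℓ y ∂(gaussianInput n) = 0 := by
    rw [h]
    exact (integral_multilinearForm _).trans hempty
  rw [apSigma, Real.sq_sqrt (variance_nonneg _ _), variance_eq_integral
    (memLp_apSum hn hcop).aestronglyMeasurable.aemeasurable, hmean, h]
  simp only [sub_zero, sq]
  exact integral_multilinearForm_mul _ _

theorem half_le_apSigma (hn : 1 < n) (hcop : Nat.Coprime n (k - 1)!) (hℓ : 1 ≤ ℓ) (hℓk : ℓ ≤ k) :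
    (n : ℝ) / 2 ≤ apSigma n k ℓ := by
  have hcard : (apIndex n k ℓ).card = n * (n / 2 * k.choose ℓ) := by
    simp [apIndex]
  have h1 : ((apIndex n k ℓ).card : ℝ) ≤ apSigma n k ℓ ^ 2 := by
    rw [apSigma_sq hn hcop hℓ]
    have e := sum_apCount_mul (n := n) (k := k) (ℓ := ℓ) fun _ => (1 : ℝ)
    simp only [mul_one, Finset.sum_const, nsmul_eq_mul] at e
    rw [← e]
    refine Finset.sum_le_sum fun T _ => ?_
    unfold apCount
    exact_mod_cast Nat.le_mul_self _
  have h2 : n * n ≤ 4 * (apIndex n k ℓ).card := by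
    have h3 : n ≤ 4 * (n / 2 * k.choose ℓ) := by
      have h4 : n / 2 ≤ n / 2 * k.choose ℓ :=
        Nat.le_mul_of_pos_right _ (Nat.choose_pos hℓk)
      omega
    rw [hcard]
    nlinarith
  have h2' : (n : ℝ) * n ≤ 4 * (apIndex n k ℓ).card := by exact_mod_cast h2
  have h0 : 0 ≤ apSigma n k ℓ := Real.sqrt_nonneg _
  refine le_of_sq_le_sq ?_ h0
  linarith [h1, h2', div_pow (n : ℝ) 2 2]

/-- The coefficients of the normalized degree `ℓ` component. -/
noncomputable def apWeight (n k ℓ : ℕ) [NeZero n] (T : Finset (ZMod n)) : ℝ :=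
  (1 / apSigma n k ℓ) * apCount n k ℓ T

theorem apNormalized_eq_multilinearForm (hn : 1 < n) (hcop : Nat.Coprime n (k - 1)!)
    (y : ZMod n → ℝ) : apNormalized n k ℓ y = multilinearForm (apWeight n k ℓ) y := by
  rw [apNormalized, apSum_eq_multilinearForm hn hcop, multilinearForm, multilinearForm,
    Finset.mul_sum]
  exact Finset.sum_congr rfl fun T _ => by rw [apWeight, mul_assoc]

theorem card_eq_of_apWeight_ne_zero (hn : 1 < n) (hcop : Nat.Coprime n (k - 1)!)
    (T : Finset (ZMod n)) (hT : apWeight n k ℓ T ≠ 0) : T.card = ℓ :=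
  card_eq_of_apCount_ne_zero hn hcop (right_ne_zero_of_mul hT)

theorem apSigma_pos (hn : 1 < n) (hcop : Nat.Coprime n (k - 1)!) (hℓ : 1 ≤ ℓ) (hℓk : ℓ ≤ k) :
    0 < apSigma n k ℓ := by
  have : (0 : ℝ) < n := by exact_mod_cast (by omega : 0 < n)
  linarith [half_le_apSigma hn hcop hℓ hℓk]

theorem sum_apWeight_sq (hn : 1 < n) (hcop : Nat.Coprime n (k - 1)!) (hℓ : 1 ≤ ℓ) (hℓk : ℓ ≤ k) :
    ∑ T, apWeight n k ℓ T * apWeight n k ℓ T = 1 := by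
  have hσ := apSigma_pos hn hcop hℓ hℓk
  have e : ∀ T, apWeight n k ℓ T * apWeight n k ℓ T =
      (1 / apSigma n k ℓ ^ 2) * (apCount n k ℓ T * apCount n k ℓ T) := fun T => by
    simp only [apWeight]; field_simp
  simp only [e, ← Finset.mul_sum]
  rw [← apSigma_sq hn hcop hℓ]
  field_simp

theorem sum_apWeight_mul_of_ne (hn : 1 < n) (hcop : Nat.Coprime n (k - 1)!) {ℓ' : ℕ}
    (h : ℓ ≠ ℓ') : ∑ T, apWeight n k ℓ T * apWeight n k ℓ' T = 0 := by
  refine Finset.sum_eq_zero fun T _ => ?_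
  by_contra h0
  exact h ((card_eq_of_apWeight_ne_zero hn hcop T (left_ne_zero_of_mul h0)).symm.trans
    (card_eq_of_apWeight_ne_zero hn hcop T (right_ne_zero_of_mul h0)))

theorem isPairSparse_apWeight (hn : 1 < n) (hcop : Nat.Coprime n (k - 1)!) (hℓ : 3 ≤ ℓ)
    (hℓk : ℓ ≤ k) : IsPairSparse (apWeight n k ℓ) k (2 * (k * (k * 2 ^ k)) / n) where
  bound_nonneg := by positivity
  nonneg T := mul_nonneg (by have := apSigma_pos hn hcop (by omega) hℓk; positivity)
    (apCount_nonneg T)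
  three_le_card T hT := by rwa [card_eq_of_apWeight_ne_zero hn hcop T hT]
  card_le T hT := by rwa [card_eq_of_apWeight_ne_zero hn hcop T hT]
  sum_pair_le x z hxz := by
    have hσ := half_le_apSigma hn hcop (by omega : 1 ≤ ℓ) hℓk
    have hn0 : (0 : ℝ) < n := by exact_mod_cast (by omega : 0 < n)
    simp only [apWeight, ← Finset.mul_sum]
    calc _ ≤ (1 / ((n : ℝ) / 2)) * (k * (k * 2 ^ k)) := by
          refine mul_le_mul (one_div_le_one_div_of_le (by positivity) hσ)
            (sum_apCount_pair_le hn hcop hxz) (Finset.sum_nonneg fun T _ => apCount_nonneg T)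
            (by positivity)
      _ = _ := by field_simp

theorem apWeight_one_singleton (x : ZMod n) : apWeight n k 1 {x} = apWeight n k 1 {0} := by
  rw [apWeight, apCount_singleton, apWeight]

/-- The degree one component is `n^{-1/2}` times the sum of all variables. -/
theorem card_mul_apWeight_one_sq (hn : 1 < n) (hcop : Nat.Coprime n (k - 1)!) (hk : 1 ≤ k) :
    (n : ℝ) * apWeight n k 1 {0} ^ 2 = 1 := by
  have h2 := sum_apWeight_sq hn hcop le_rfl hk
  have e : ∀ T, apWeight n k 1 T * apWeight n k 1 T =
      if T ∈ Finset.univ.image (fun x : ZMod n => ({x} : Finset (ZMod n))) then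
        apWeight n k 1 {0} ^ 2 else 0 := by
    intro T
    split_ifs with hT
    · obtain ⟨x, -, rfl⟩ := Finset.mem_image.1 hT
      rw [apWeight_one_singleton, sq]
    · by_contra h0
      obtain ⟨x, rfl⟩ := Finset.card_eq_one.1
        (card_eq_of_apWeight_ne_zero hn hcop T (left_ne_zero_of_mul h0))
      exact hT (Finset.mem_image_of_mem _ (Finset.mem_univ x))
  simp only [e, Finset.sum_ite_mem, Finset.univ_inter, Finset.sum_const, nsmul_eq_mul] at h2
  rwa [Finset.card_image_of_injective _ Finset.singleton_injective, Finset.card_univ,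
    ZMod.card] at h2

end Progressions

/-! ### The normal approximation -/

section NormalApproximation

/-- A constant `B` such that the deviations of the normalized gradient pairings from their means
have second moment at most `B / n`. -/
noncomputable def gramConstant (k : ℕ) : ℝ :=
  3 ^ (4 * k) * (288 * k ^ 7 * (2 * (k * (k * 2 ^ k))) ^ 4) + k ^ 4 * (2 * (k * (k * 2 ^ k))) ^ 2

theorem gramConstant_pos {k : ℕ} (hk : 1 ≤ k) : 0 < gramConstant k := by
  unfold gramConstant
  positivity

variable {n k : ℕ} [NeZero n]

theorem integral_abs_gradientPairing_apWeight_sub_le (hn : 1 < n) (hcop : Nat.Coprime n (k - 1)!)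
    (hk : 1 ≤ k) {ℓ ℓ' : ℕ} (hℓ : ℓ = 1 ∨ 3 ≤ ℓ) (hℓk : ℓ ≤ k) (hℓ' : ℓ' = 1 ∨ 3 ≤ ℓ')
    (hℓk' : ℓ' ≤ k) :
    ∫ y, |(ℓ' : ℝ)⁻¹ * gradientPairing (apWeight n k ℓ) (apWeight n k ℓ') y -
      if ℓ = ℓ' then 1 else 0| ∂(stdNormalPi (ZMod n)) ≤ √(gramConstant k / n) := by
  have hn0 : (0 : ℝ) < n := by exact_mod_cast (by omega : 0 < n)
  have hB : 0 < gramConstant k / n := div_pos (gramConstant_pos hk) hn0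
  have hδ : ∑ T, apWeight n k ℓ T * apWeight n k ℓ' T = if ℓ = ℓ' then 1 else 0 := by
    split_ifs with h
    · subst h
      exact sum_apWeight_sq hn hcop (by omega) hℓk
    · exact sum_apWeight_mul_of_ne hn hcop h
  have hc := card_mul_apWeight_one_sq hn hcop hk
  have hlin : apWeight n k 1 {0} ^ 2 * ((k : ℝ) ^ 4 * Fintype.card (ZMod n) ^ 2 *
      (2 * (k * (k * 2 ^ k)) / n) ^ 2) ≤ gramConstant k / n := by
    have hc' : apWeight n k 1 {0} ^ 2 = 1 / n := by field_simp; linarith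
    rw [hc', ZMod.card, gramConstant, add_div]
    refine le_add_of_nonneg_of_le (by positivity) (le_of_eq ?_)
    field_simp
  rcases hℓ with rfl | hℓ <;> rcases hℓ' with rfl | hℓ'
  · have e : ∀ y, gradientPairing (apWeight n k 1) (apWeight n k 1) y = 1 := fun y => by
      simp only [gradientPairing, multilinearPartial_of_card_eq_one
        (card_eq_of_apWeight_ne_zero hn hcop), apWeight_one_singleton, Finset.sum_const,
        Finset.card_univ, ZMod.card, nsmul_eq_mul]
      rw [← sq, hc]
    simp only [e, Nat.cast_one, inv_one, mul_one, if_true, sub_self, abs_zero, integral_zero]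
    exact Real.sqrt_nonneg _
  · rw [if_neg (by omega)]
    simp only [sub_zero]
    exact integral_abs_gradientPairing_le_of_linear (card_eq_of_apWeight_ne_zero hn hcop)
      apWeight_one_singleton (isPairSparse_apWeight hn hcop hℓ' hℓk') (by omega) hB hlin
  · rw [if_neg (by omega)]
    simp only [sub_zero, gradientPairing_comm (apWeight n k ℓ)]
    exact integral_abs_gradientPairing_le_of_linear (card_eq_of_apWeight_ne_zero hn hcop)
      apWeight_one_singleton (isPairSparse_apWeight hn hcop hℓ hℓk) le_rfl hB hlin
  · rw [← hδ]
    refine integral_abs_gradientPairing_sub_le_of_sparse (isPairSparse_apWeight hn hcop hℓ hℓk)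
      (isPairSparse_apWeight hn hcop hℓ' hℓk') (by omega)
      (card_eq_of_apWeight_ne_zero hn hcop) hB ?_
    rw [ZMod.card, gramConstant, add_div]
    refine le_add_of_le_of_nonneg (le_of_eq ?_) (by positivity)
    field_simp

theorem apDegree_eq_one_or (j : ℕ) : apDegree j = 1 ∨ 3 ≤ apDegree j := by
  unfold apDegree
  split_ifs <;> omega

theorem apDegree_injective : Function.Injective apDegree := by
  intro i j h
  unfold apDegree at h
  split_ifs at h <;> omega

theorem apDegree_le (hk : 3 ≤ k) (j : Fin (k - 1)) : apDegree j ≤ k := by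
  have := j.2
  unfold apDegree
  split_ifs <;> omega

theorem apVector_eq (hn : 1 < n) (hcop : Nat.Coprime n (k - 1)!) (y : ZMod n → ℝ) :
    apVector n k y =
      WithLp.toLp 2 fun j : Fin (k - 1) => multilinearForm (apWeight n k (apDegree j)) y := by
  simp only [apVector, apNormalized_eq_multilinearForm hn hcop]

/-- The normal approximation with an explicit constant, in terms of a bound on the second
derivative. -/
theorem abs_integral_apVector_sub_le (hk : 3 ≤ k) (hn : 1 < n) (hcop : Nat.Coprime n (k - 1)!)
    {g : EuclideanSpace ℝ (Fin (k - 1)) → ℝ} (hg : ContDiff ℝ 2 g) {M : ℝ}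
    (hM : ∀ v, ‖fderiv ℝ (fderiv ℝ g) v‖ ≤ M) :
    |(∫ y, g (apVector n k y) ∂(gaussianInput n)) -
        ∫ z, g z ∂(stdGaussian (EuclideanSpace ℝ (Fin (k - 1))))| ≤
      Real.pi / 2 * ((k - 1 : ℕ) ^ 2 * √(gramConstant k)) / √(n : ℝ) * M := by
  have hM0 : 0 ≤ M := le_trans (norm_nonneg (fderiv ℝ (fderiv ℝ g) 0)) (hM 0)
  have hF : ∀ j : Fin (k - 1), IsMultiaffineHomogeneous ((apDegree j : ℕ) : ℝ)
      (multilinearForm (apWeight n k (apDegree j)))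
      (multilinearPartial (apWeight n k (apDegree j))) := fun j =>
    isMultiaffineHomogeneous_multilinearForm (card_eq_of_apWeight_ne_zero hn hcop)
  have hℓ0 : ∀ j : Fin (k - 1), ((apDegree j : ℕ) : ℝ) ≠ 0 := fun j => by
    have := apDegree_eq_one_or j
    exact Nat.cast_ne_zero.2 (by omega)
  have h := abs_integral_sub_integral_stdGaussian_le hg hM hF hℓ0
  simp only [apVector_eq hn hcop]
  refine h.trans ?_
  have hsum : ∑ i : Fin (k - 1), ∑ j : Fin (k - 1), ∫ y, |gradientGram
      (fun j : Fin (k - 1) => ((apDegree j : ℕ) : ℝ))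
      (fun j : Fin (k - 1) => multilinearPartial (apWeight n k (apDegree j))) i j y -
        if i = j then 1 else 0| ∂(stdNormalPi (ZMod n)) ≤
      (k - 1 : ℕ) ^ 2 * √(gramConstant k / n) := by
    have hij : ∀ i j : Fin (k - 1), ∫ y, |gradientGram
        (fun j : Fin (k - 1) => ((apDegree j : ℕ) : ℝ))
        (fun j : Fin (k - 1) => multilinearPartial (apWeight n k (apDegree j))) i j y -
          if i = j then 1 else 0| ∂(stdNormalPi (ZMod n)) ≤ √(gramConstant k / n) := by
      intro i j
      have hiff : i = j ↔ apDegree i = apDegree j :=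
        ⟨fun h => by rw [h], fun h => Fin.ext (apDegree_injective h)⟩
      simp only [hiff]
      exact integral_abs_gradientPairing_apWeight_sub_le hn hcop (by omega)
        (apDegree_eq_one_or i) (apDegree_le hk i) (apDegree_eq_one_or j) (apDegree_le hk j)
    refine (Finset.sum_le_card_nsmul _ _ _ fun i _ =>
      Finset.sum_le_card_nsmul _ _ _ fun j _ => hij i j).trans (le_of_eq ?_)
    simp only [Finset.card_univ, Fintype.card_fin, nsmul_eq_mul]
    ring
  calc _ ≤ Real.pi / 2 * (M * ((k - 1 : ℕ) ^ 2 * √(gramConstant k / n))) := by gcongr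
    _ = _ := by
      rw [Real.sqrt_div (gramConstant_pos (by omega)).le]
      ring

theorem norm_fderiv_fderiv_le_derivSup {m : ℕ} {g : EuclideanSpace ℝ (Fin m) → ℝ}
    (h : derivSup 2 g ≠ ∞) (v : EuclideanSpace ℝ (Fin m)) :
    ‖fderiv ℝ (fderiv ℝ g) v‖ ≤ (derivSup 2 g).toReal := by
  have h1 : ‖fderiv ℝ (fderiv ℝ g) v‖ = ‖iteratedFDeriv ℝ 2 g v‖ := by
    rw [← norm_iteratedFDeriv_fderiv (n := 1), norm_iteratedFDeriv_one]
  rw [h1, ← toReal_enorm]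
  exact ENNReal.toReal_mono h (le_iSup (fun x => ‖iteratedFDeriv ℝ 2 g x‖ₑ) v)

theorem integrable_comp_apVector (hn : 1 < n) (hcop : Nat.Coprime n (k - 1)!)
    {g : EuclideanSpace ℝ (Fin (k - 1)) → ℝ} (hg : ContDiff ℝ 2 g) {M : ℝ}
    (hM : ∀ v, ‖fderiv ℝ (fderiv ℝ g) v‖ ≤ M) :
    Integrable (fun y => g (apVector n k y)) (gaussianInput n) := by
  simp only [apVector_eq hn hcop, ← sum_smul_single]
  exact (PolyGrowth.comp_of_norm_fderiv_fderiv_le hg hM (PolyGrowth.sum _ fun j _ =>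
    (polyGrowth_multilinearForm _).smul (PolyGrowth.const _))).integrable

theorem integrable_stdGaussian_of_norm_fderiv_fderiv_le {m : ℕ}
    {g : EuclideanSpace ℝ (Fin m) → ℝ} (hg : ContDiff ℝ 2 g) {M : ℝ}
    (hM : ∀ v, ‖fderiv ℝ (fderiv ℝ g) v‖ ≤ M) :
    Integrable g (stdGaussian (EuclideanSpace ℝ (Fin m))) := by
  rw [← map_pi_eq_stdGaussian, integrable_map_measure hg.continuous.aestronglyMeasurable
    (by fun_prop)]
  have h := (PolyGrowth.comp_of_norm_fderiv_fderiv_le hg hM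
    (PolyGrowth.sum Finset.univ fun (j : Fin m) _ => (PolyGrowth.coord j).smul
      (PolyGrowth.const (EuclideanSpace.single j (1 : ℝ))))).integrable
  simp only [sum_smul_single] at h
  exact h

end NormalApproximation

theorem theorem2 (k : ℕ) (hk : 3 ≤ k) :
    ∃ C : ℝ, 0 < C ∧
      ∀ (n : ℕ) [NeZero n], 1 < n → Nat.Coprime n (k - 1)! →
        ∀ g : EuclideanSpace ℝ (Fin (k - 1)) → ℝ, ContDiff ℝ 3 g →
          (derivSup 2 g + derivSup 3 g < ∞ →
            Integrable (fun y => g (apVector n k y)) (gaussianInput n) ∧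
            Integrable g (stdGaussian (EuclideanSpace ℝ (Fin (k - 1))))) ∧
          ENNReal.ofReal |(∫ y, g (apVector n k y) ∂(gaussianInput n)) -
              ∫ z, g z ∂(stdGaussian (EuclideanSpace ℝ (Fin (k - 1))))| ≤
            ENNReal.ofReal (C / √(n : ℝ)) * (derivSup 2 g + derivSup 3 g) := by
  have hC : 0 < Real.pi / 2 * (((k - 1 : ℕ) : ℝ) ^ 2 * √(gramConstant k)) := by
    have h1 : (0 : ℝ) < (k - 1 : ℕ) := by exact_mod_cast (by omega : 0 < k - 1)
    have h2 : 0 < √(gramConstant k) := Real.sqrt_pos.2 (gramConstant_pos (by omega))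
    have h3 := Real.pi_pos
    positivity
  refine ⟨_, hC, fun n _ hn hcop g hg3 => ?_⟩
  have hg : ContDiff ℝ 2 g := hg3.of_le (by norm_num)
  have hn0 : (0 : ℝ) < √(n : ℝ) := Real.sqrt_pos.2 (by exact_mod_cast (by omega : 0 < n))
  by_cases htop : derivSup 2 g + derivSup 3 g = ∞
  · refine ⟨fun h => absurd htop h.ne, ?_⟩
    -- the right-hand side is infinite, its first factor being positive
    rw [htop, ENNReal.mul_top (ENNReal.ofReal_pos.2 (div_pos hC hn0)).ne']
    exact le_top
  · have h2 : derivSup 2 g ≠ ∞ := fun h => htop (by rw [h, top_add])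
    have hM := norm_fderiv_fderiv_le_derivSup h2
    refine ⟨fun _ => ⟨integrable_comp_apVector hn hcop hg hM,
      integrable_stdGaussian_of_norm_fderiv_fderiv_le hg hM⟩, ?_⟩
    refine (ENNReal.ofReal_le_ofReal (abs_integral_apVector_sub_le hk hn hcop hg hM)).trans ?_
    rw [ENNReal.ofReal_mul (div_pos hC hn0).le, ENNReal.ofReal_toReal h2]
    gcongr
    exact le_self_add
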